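/- \textbf{Theorem (Network tomography for node congestion).} Let $\mathcal N=(\mathcal V,\mathcal E)$ be a connected undirected network with $|\mathcal V|\ge 2$ nodes and diameter $D$. Every node $v$ has an unknown real delay $d_v$; $v$ is \emph{congested} if $d_v\neq 0$, and a congested node is \emph{isolated} if it has a neighbour that is not congested. Sending a packet along a path (a walk $v_1,v_2,\dots,v_{T+1}$ in $\mathcal N$, in which nodes and links may be repeated) yields the end-to-end delay $d_{v_1}+\dots+d_{v_{T+1}}$, i.e.\ $\sum_v W_v d_v$, where $W_v$ is the number of times that the path visits $v$. A \emph{tomography scheme} draws at random, from a distribution that depends only on $\mathcal N$ and the parameters below and not on the delays, a list of measurement paths together with a finite table of natural numbers; a reconstruction program is then given the measured end-to-end delays and the table. Programs run on a random access machine with real arithmetic, on which each arithmetic operation, comparison and memory access counts as one operation. There is one reconstruction program such that for every $\rho_0>0$ there is a constant $C>0$ for which the following holds. Let $k\ge 1$ and $M\ge 2$ be integers, let $\rho\ge\rho_0$ be real with $\rho k\le|\mathcal V|$, and let $\mathcal N$ be as above. Then there is a tomography scheme for $\mathcal N$ (``FRANTIC'') with these properties: \begin{enumerate} \item it always uses at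 most $C\rho k\lceil\log|\mathcal V|/\log M\rceil$ measurements; \item for every delay vector $d\in\mathbb R^{\mathcal V}$ with at most $k$ congested nodes, all of them isolated, the program halts with output exactly $d$ with probability at least $1-C/(\rho k)$ over the drawn scheme; \item for every such $d$ and every outcome of the draw, the program halts after at most $C\rho k\lceil\log|\mathcal V|/\log M\rceil$ operations; \item each measurement path traverses at most $C\,D|\mathcal V|/(\rho k)$ distinct links and has at most $C\,DM|\mathcal V|/(\rho k)$ hops (links counted with multiplicity). \end{enumerate} -/

import Mathlib

namespace Tomography

/-! ### Networks, delays and path measurements -/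

/-- A congested node (one with non-zero delay) is isolated if one of its neighbours is not
congested. -/
def IsIsolated {n : ℕ} (G : SimpleGraph (Fin n)) (d : Fin n → ℝ) (v : Fin n) : Prop :=
  ∃ w, G.Adj v w ∧ d w = 0

/-- The node delay vectors under consideration: at most `k` nodes are congested, and every
congested node is isolated. -/
def Admissible {n : ℕ} (G : SimpleGraph (Fin n)) (k : ℕ) (d : Fin n → ℝ) : Prop :=
  {v | d v ≠ 0}.ncard ≤ k ∧ ∀ v, d v ≠ 0 → IsIsolated G d v

/-- A measurement path. Nodes and links may be visited repeatedly, so it is a walk. -/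
structure Route {n : ℕ} (G : SimpleGraph (Fin n)) where
  source : Fin n
  target : Fin n
  walk : G.Walk source target

/-- The end-to-end delay of a packet sent along a path: every visit of a node `v` adds `d v`. -/
def Route.delay {n : ℕ} {G : SimpleGraph (Fin n)} (p : Route G) (d : Fin n → ℝ) : ℝ :=
  ∑ v, (p.walk.support.count v : ℝ) * d v

/-- The number of (distinct) links of the network which the path traverses. -/
def Route.numLinks {n : ℕ} {G : SimpleGraph (Fin n)} (p : Route G) : ℕ :=
  p.walk.edges.toFinset.card

/-- The total number of hops of the path, that is, its links counted with multiplicity. -/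
def Route.numHops {n : ℕ} {G : SimpleGraph (Fin n)} (p : Route G) : ℕ :=
  p.walk.length

/-- What is fixed before anything is measured: the paths along which packets are sent, and a
table of integers that describes the design to the reconstruction algorithm. -/
structure Design {n : ℕ} (G : SimpleGraph (Fin n)) where
  routes : List (Route G)
  table : List ℕ

/-- The vector of measurement outputs. -/
def Design.outputs {n : ℕ} {G : SimpleGraph (Fin n)} (D : Design G) (d : Fin n → ℝ) : List ℝ :=
  D.routes.map fun p => p.delay d

/-! ### A random access machine over the reals with unit costs -/

/-- The memory: countably many arrays of real numbers; `s a j` is cell `j` of array `a`. -/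
abbrev Memory := ℕ → ℕ → ℝ

open Classical in
/-- Read the cell of array `a` whose index is the number `x`. If `x` is not a natural number,
there is no such cell, and the result is `0`. -/
noncomputable def Memory.read (s : Memory) (a : ℕ) (x : ℝ) : ℝ :=
  if ∃ j : ℕ, (j : ℝ) = x then s a ⌊x⌋₊ else 0

open Classical in
/-- Write `y` to the cell of array `a` whose index is the number `x`. If `x` is not a natural
number, there is no such cell, and nothing happens. -/
noncomputable def Memory.write (s : Memory) (a : ℕ) (x y : ℝ) : Memory :=
  fun b i => if b = a ∧ (i : ℝ) = x then y else s b i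

/-- Expressions: literals, array cells with a computed index, and the four arithmetic
operations. -/
inductive Expr where
  | lit (c : ℕ)
  | cell (a : ℕ) (index : Expr)
  | plus (e f : Expr)
  | minus (e f : Expr)
  | times (e f : Expr)
  | divided (e f : Expr)

/-- The value of an expression (division by zero gives zero). -/
noncomputable def Expr.eval (s : Memory) : Expr → ℝ
  | .lit c => c
  | .cell a e => s.read a (e.eval s)
  | .plus e f => e.eval s + f.eval s
  | .minus e f => e.eval s - f.eval s
  | .times e f => e.eval s * f.eval s
  | .divided e f => e.eval s / f.eval s

/-- The cost of evaluating an expression: every literal, memory access and arithmetic operation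
counts as one operation. -/
def Expr.cost : Expr → ℕ
  | .lit _ => 1
  | .cell _ e => e.cost + 1
  | .plus e f => e.cost + f.cost + 1
  | .minus e f => e.cost + f.cost + 1
  | .times e f => e.cost + f.cost + 1
  | .divided e f => e.cost + f.cost + 1

/-- Programs: assignment `a[i] := e`, sequencing, branching and looping on a comparison
`e ≤ f`. -/
inductive Program where
  | skip
  | assign (a : ℕ) (i e : Expr)
  | seq (p q : Program)
  | ite (e f : Expr) (p q : Program)
  | loop (e f : Expr) (p : Program)

/-- `Exec p s s' t`: started on memory `s`, the program `p` halts with memory `s'` after exactly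
`t` operations. Each assignment and each comparison is one operation, on top of the cost of the
expressions in it. -/
inductive Exec : Program → Memory → Memory → ℕ → Prop where
  | skip (s : Memory) : Exec .skip s s 0
  | assign (a : ℕ) (i e : Expr) (s : Memory) :
      Exec (.assign a i e) s (s.write a (i.eval s) (e.eval s)) (i.cost + e.cost + 1)
  | seq {p q : Program} {s s' s'' : Memory} {t t' : ℕ} :
      Exec p s s' t → Exec q s' s'' t' → Exec (.seq p q) s s'' (t + t')
  | iteTrue {e f : Expr} {p q : Program} {s s' : Memory} {t : ℕ} :
      e.eval s ≤ f.eval s → Exec p s s' t →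
      Exec (.ite e f p q) s s' (e.cost + f.cost + 1 + t)
  | iteFalse {e f : Expr} {p q : Program} {s s' : Memory} {t : ℕ} :
      ¬ e.eval s ≤ f.eval s → Exec q s s' t →
      Exec (.ite e f p q) s s' (e.cost + f.cost + 1 + t)
  | loopTrue {e f : Expr} {p : Program} {s s' s'' : Memory} {t t' : ℕ} :
      e.eval s ≤ f.eval s → Exec p s s' t → Exec (.loop e f p) s' s'' t' →
      Exec (.loop e f p) s s'' (e.cost + f.cost + 1 + t + t')
  | loopFalse {e f : Expr} {p : Program} {s : Memory} :
      ¬ e.eval s ≤ f.eval s → Exec (.loop e f p) s s (e.cost + f.cost + 1)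

/-- Programs are deterministic: the final memory and the number of operations are determined. -/
theorem Exec.det {p : Program} {s s₁ s₂ : Memory} {t₁ t₂ : ℕ}
    (h₁ : Exec p s s₁ t₁) (h₂ : Exec p s s₂ t₂) : s₁ = s₂ ∧ t₁ = t₂ := by
  induction h₁ generalizing s₂ t₂ with
  | skip s => cases h₂; exact ⟨rfl, rfl⟩
  | assign a i e s => cases h₂; exact ⟨rfl, rfl⟩
  | seq _ _ ih ih' =>
    cases h₂ with
    | seq g g' =>
      obtain ⟨rfl, rfl⟩ := ih g
      obtain ⟨rfl, rfl⟩ := ih' g'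
      exact ⟨rfl, rfl⟩
  | iteTrue hc _ ih =>
    cases h₂ with
    | iteTrue _ g => obtain ⟨rfl, rfl⟩ := ih g; exact ⟨rfl, rfl⟩
    | iteFalse gc _ => exact absurd hc gc
  | iteFalse hc _ ih =>
    cases h₂ with
    | iteTrue gc _ => exact absurd gc hc
    | iteFalse _ g => obtain ⟨rfl, rfl⟩ := ih g; exact ⟨rfl, rfl⟩
  | loopTrue hc _ _ ih ih' =>
    cases h₂ with
    | loopTrue _ g g' =>
      obtain ⟨rfl, rfl⟩ := ih g
      obtain ⟨rfl, rfl⟩ := ih' g'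
      exact ⟨rfl, rfl⟩
    | loopFalse gc => exact absurd hc gc
  | loopFalse hc =>
    cases h₂ with
    | loopTrue gc _ _ => exact absurd gc hc
    | loopFalse _ => exact ⟨rfl, rfl⟩

/-! ### Reconstruction -/

/-- The memory on which the reconstruction starts: the measurement outputs in array `0`, the table
of the design in array `1`, and zeros everywhere else. The delay vector itself enters only through
the measurement outputs. -/
def Design.initial {n : ℕ} {G : SimpleGraph (Fin n)} (D : Design G) (d : Fin n → ℝ) : Memory
  | 0, j => (D.outputs d).getD j 0
  | 1, j => (D.table.getD j 0 : ℕ)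
  | _, _ => 0

/-- The program `A` halts after at most `T` operations on the measurement outputs of the design
`D` for the delay vector `d`. -/
def Design.HaltsWithin {n : ℕ} {G : SimpleGraph (Fin n)} (D : Design G) (A : Program)
    (d : Fin n → ℝ) (T : ℝ) : Prop :=
  ∃ (s : Memory) (t : ℕ), Exec A (D.initial d) s t ∧ (t : ℝ) ≤ T

/-- The program `A` halts on the measurement outputs of the design `D` for the delay vector `d`,
and the output array (array `2`) then holds `d`. -/
def Design.Recovers {n : ℕ} {G : SimpleGraph (Fin n)} (D : Design G) (A : Program)
    (d : Fin n → ℝ) : Prop :=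
  ∃ (s : Memory) (t : ℕ), Exec A (D.initial d) s t ∧ ∀ v : Fin n, s 2 v = d v

end Tomography

/-! The network can be removed from the problem. Fix a root `z` and, for each node `v`, a walk of
length at most the diameter from `v` to `z`. Travel along this walk and back, repeating every second
link `r` times, once beginning with the first link and once with the second. The two delays differ
by an alternating sum over consecutive links, which telescopes to `r * (d v - (-1) ^ length * d z)`
(`tailDelay_oscillation`). Concatenating such excursions over a set of nodes, and correcting by a
known multiple of `d z`, which is measured on its own, turns two measurements into any prescribed
mixture `∑ w v * d v` with natural weights (`Sketch.initial_design_mixture`).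

What remains is sparse recovery from mixtures. Four random hash functions with `m` values, `m` of
order `ρ k`, put each node into four buckets; overfull buckets are split, which keeps the tours
short. With `L = ⌈log n / log M⌉`, each bucket has `4 L + 1` mixtures: one with all weights `1`, `L`
with the base-`M` digits of the node as weights, and `3 L` with random digits. If a bucket contains
a single congested node, the first mixture is its delay, the ratios of the next `L` to the first
spell its name, and all of them together confirm the guess. A confirmed node is subtracted from its
buckets, which may leave other nodes alone in theirs. A queue of touched buckets limits this peeling
to `8 m + 4 k` inspections of cost `O(L)`, and every loop bound is read from the table, so the
running time does not depend on success.

There are two ways to fail. Peeling gets stuck only on a core, a nonempty set of congested nodes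
none of which is alone in any bucket (`rest_peel_eq_empty`); a union bound over sets gives
probability at most `1 / m` (`card_exists_isCore_le`). Or a mixture of several nodes passes the test
for some node `u`; the random digits make this as rare as `n⁻³` for given `u`
(`card_mixture_eq_le`). The sets met by error-free peeling depend on the hash functions and the
congested set but not on the random digits, so a union bound over nodes and steps gives `(8 m + 4 k)
/ n ^ 2` (`card_exists_mixture_eq_le`). Both are `O(1 / (ρ k))` because `ρ k ≤ n`. -/

namespace Tomography

open SimpleGraph

/-! ### Oscillating walks -/

section Walks

variable {n : ℕ} {G : SimpleGraph (Fin n)}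

/-- The delay along a walk, not counting the node where it starts. -/
def tailDelay (d : Fin n → ℝ) {u v : Fin n} (p : G.Walk u v) : ℝ :=
  (p.support.tail.map d).sum

@[simp] theorem tailDelay_nil (d : Fin n → ℝ) (u : Fin n) :
    tailDelay d (Walk.nil : G.Walk u u) = 0 := by
  simp [tailDelay]

@[simp] theorem tailDelay_cons (d : Fin n → ℝ) {u v w : Fin n} (h : G.Adj u v)
    (p : G.Walk v w) : tailDelay d (Walk.cons h p) = d v + tailDelay d p := by
  rw [tailDelay, tailDelay, Walk.support_cons, List.tail_cons]
  conv_lhs => rw [← Walk.cons_tail_support p, List.map_cons, List.sum_cons]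

@[simp] theorem tailDelay_append (d : Fin n → ℝ) {u v w : Fin n} (p : G.Walk u v)
    (q : G.Walk v w) : tailDelay d (p.append q) = tailDelay d p + tailDelay d q := by
  simp [tailDelay, Walk.tail_support_append]

theorem Route.delay_eq (p : Route G) (d : Fin n → ℝ) :
    p.delay d = d p.source + tailDelay d p.walk := by
  have h : p.delay d = (p.walk.support.map d).sum := by
    rw [Route.delay, Finset.sum_list_map_count]
    rw [← Finset.sum_subset (Finset.subset_univ p.walk.support.toFinset)]
    · simp
    · intro v _ hv
      rw [List.mem_toFinset] at hv
      simp [List.count_eq_zero_of_not_mem hv]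
  rw [h, tailDelay]
  conv_lhs => rw [← Walk.cons_tail_support p.walk, List.map_cons, List.sum_cons]

/-- The walk that goes along a link and back `r` times. -/
def zigzag {u v : Fin n} (h : G.Adj u v) : ℕ → G.Walk u u
  | 0 => .nil
  | r + 1 => .cons h (.cons h.symm (zigzag h r))

theorem tailDelay_zigzag (d : Fin n → ℝ) {u v : Fin n} (h : G.Adj u v) (r : ℕ) :
    tailDelay d (zigzag h r) = r * (d u + d v) := by
  induction r with
  | zero => simp [zigzag]
  | succ r ih => simp only [zigzag, tailDelay_cons, ih]; push_cast; ring

theorem length_zigzag {u v : Fin n} (h : G.Adj u v) (r : ℕ) :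
    (zigzag h r).length = 2 * r := by
  induction r with
  | zero => rfl
  | succ r ih => simp only [zigzag, Walk.length_cons, ih]; ring

theorem edges_zigzag {u v : Fin n} (h : G.Adj u v) (r : ℕ) :
    ∀ e ∈ (zigzag h r).edges, e = s(u, v) := by
  induction r with
  | zero => simp [zigzag]
  | succ r ih =>
    intro e he
    simp only [zigzag, Walk.edges_cons, List.mem_cons] at he
    rcases he with rfl | rfl | he
    · rfl
    · exact Sym2.eq_swap
    · exact ih e he

/-- The closed walk along `p` and back which repeats every second link `r` times, beginning with
the first link if `b` is true and with the second one otherwise. -/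
def oscillation (r : ℕ) : (b : Bool) → {u v : Fin n} → G.Walk u v → G.Walk u u
  | _, _, _, .nil => .nil
  | b, _, _, .cons h p =>
    (zigzag h (if b then r else 0)).append
      (.cons h ((oscillation r (!b) p).append (.cons h.symm .nil)))

/-- Repeating the link `x y` adds `r * (d x + d y)`. The plain passages cancel in the difference,
and the repeated links enter with alternating signs, so all inner nodes cancel. -/
theorem tailDelay_oscillation (d : Fin n → ℝ) (r : ℕ) {u v : Fin n} (p : G.Walk u v) :
    tailDelay d (oscillation r true p) - tailDelay d (oscillation r false p) =
      r * (d u - (-1) ^ p.length * d v) := by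
  induction p with
  | nil => simp [oscillation]
  | cons h p ih =>
    simp only [oscillation, tailDelay_append, tailDelay_cons, tailDelay_zigzag, tailDelay_nil,
      Bool.not_true, Bool.not_false, Walk.length_cons, pow_succ]
    simp
    linarith

theorem length_oscillation (r : ℕ) (b : Bool) {u v : Fin n} (p : G.Walk u v) :
    (oscillation r b p).length ≤ (2 * r + 2) * p.length := by
  induction p generalizing b with
  | nil => simp [oscillation]
  | cons h p ih =>
    simp only [oscillation, Walk.length_append, Walk.length_cons, length_zigzag, Walk.length_nil]
    have := ih (!b)
    split_ifs <;> nlinarith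

theorem edges_oscillation (r : ℕ) (b : Bool) {u v : Fin n} (p : G.Walk u v) :
    ∀ e ∈ (oscillation r b p).edges, e ∈ p.edges := by
  induction p generalizing b with
  | nil => simp [oscillation]
  | cons h p ih =>
    intro e he
    simp only [oscillation, Walk.edges_append, Walk.edges_cons, Walk.edges_nil, List.mem_append,
      List.mem_cons, List.not_mem_nil, or_false] at he ⊢
    rcases he with he | rfl | he | rfl
    · exact .inl (edges_zigzag h _ e he)
    · exact .inl rfl
    · exact .inr (ih _ e he)
    · exact .inl Sym2.eq_swap

/-- The closed walk at `z` which visits the nodes of a list one after the other, by the walks `p`,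
and oscillates `w v` times along `p v` when it is at `v`. -/
def tour {z : Fin n} (p : ∀ v, G.Walk v z) (w : Fin n → ℕ) (b : Bool) :
    List (Fin n) → G.Walk z z
  | [] => .nil
  | v :: l => (p v).reverse.append ((oscillation (w v) b (p v)).append ((p v).append
      (tour p w b l)))

theorem tailDelay_tour {z : Fin n} (p : ∀ v, G.Walk v z) (w : Fin n → ℕ) (d : Fin n → ℝ)
    (l : List (Fin n)) :
    tailDelay d (tour p w true l) - tailDelay d (tour p w false l) =
      (l.map fun v => (w v : ℝ) * (d v - (-1) ^ (p v).length * d z)).sum := by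
  induction l with
  | nil => simp [tour]
  | cons v l ih =>
    simp only [tour, tailDelay_append, List.map_cons, List.sum_cons]
    have := tailDelay_oscillation d (w v) (p v)
    linarith

/-- Each node contributes the way there and back, at most `2 * D`, and one oscillation, at most `(2
* M + 2) * D`. -/
theorem length_tour {z : Fin n} (p : ∀ v, G.Walk v z) (w : Fin n → ℕ) (b : Bool) {D M : ℕ}
    (hp : ∀ v, (p v).length ≤ D) (hw : ∀ v, w v ≤ M) (l : List (Fin n)) :
    (tour p w b l).length ≤ (2 * M + 4) * D * l.length := by
  induction l with
  | nil => simp [tour]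
  | cons v l ih =>
    simp only [tour, Walk.length_append, Walk.length_reverse, List.length_cons]
    have h1 := length_oscillation (w v) b (p v)
    have h2 : (2 * w v + 2) * (p v).length ≤ (2 * M + 2) * D :=
      Nat.mul_le_mul (by have := hw v; omega) (hp v)
    have h3 := hp v
    nlinarith

theorem edges_tour {z : Fin n} (p : ∀ v, G.Walk v z) (w : Fin n → ℕ) (b : Bool)
    (l : List (Fin n)) :
    ∀ e ∈ (tour p w b l).edges, ∃ v ∈ l, e ∈ (p v).edges := by
  induction l with
  | nil => simp [tour]
  | cons v l ih =>
    intro e he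
    simp only [tour, Walk.edges_append, Walk.edges_reverse, List.mem_append,
      List.mem_reverse] at he
    rcases he with he | he | he | he
    · exact ⟨v, by simp, he⟩
    · exact ⟨v, by simp, edges_oscillation _ _ _ e he⟩
    · exact ⟨v, by simp, he⟩
    · obtain ⟨x, hx, h⟩ := ih e he
      exact ⟨x, by simp [hx], h⟩

/-- Oscillating reuses the links of `p v`, so the count of distinct links is free of the weights and
of the factor `M`. -/
theorem card_edges_tour {z : Fin n} (p : ∀ v, G.Walk v z) (w : Fin n → ℕ) (b : Bool) {D : ℕ}
    (hp : ∀ v, (p v).length ≤ D) (l : List (Fin n)) :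
    (tour p w b l).edges.toFinset.card ≤ D * l.length := by
  have h : (tour p w b l).edges.toFinset ⊆ l.toFinset.biUnion fun v => (p v).edges.toFinset := by
    intro e he
    obtain ⟨v, hv, h⟩ := edges_tour p w b l e (by simpa using he)
    simp only [Finset.mem_biUnion, List.mem_toFinset]
    exact ⟨v, hv, h⟩
  calc _ ≤ _ := Finset.card_le_card h
    _ ≤ l.toFinset.card * D := Finset.card_biUnion_le_card_mul _ _ _ fun v _ =>
        (List.toFinset_card_le _).trans (by rw [Walk.length_edges]; exact hp v)
    _ ≤ D * l.length := by
        rw [mul_comm]; exact Nat.mul_le_mul_left _ (List.toFinset_card_le _)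

end Walks

/-! ### Hashing into small buckets -/

section Refine

variable {n m : ℕ}

/-- The number of nodes that precede `v` when the nodes are sorted by their value under `f`. -/
def rankBy (f : Fin n → Fin m) (v : Fin n) : ℕ :=
  (Finset.univ.filter fun u => f u < f v ∨ (f u = f v ∧ u < v)).card

theorem rankBy_lt_of_lt (f : Fin n → Fin m) {u v : Fin n}
    (h : f u < f v ∨ (f u = f v ∧ u < v)) : rankBy f u < rankBy f v := by
  apply Finset.card_lt_card
  rw [Finset.ssubset_iff_of_subset]
  · exact ⟨u, by simpa using h, by simp⟩
  · intro x hx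
    simp only [Finset.mem_filter, Finset.mem_univ, true_and] at hx ⊢
    omega

theorem rankBy_injective (f : Fin n → Fin m) : Function.Injective (rankBy f) := by
  intro u v h
  by_contra hne
  rcases lt_trichotomy (f u) (f v) with h1 | h1 | h1
  · exact (rankBy_lt_of_lt f (.inl h1)).ne h
  · rcases lt_or_gt_of_ne hne with h2 | h2
    · exact (rankBy_lt_of_lt f (.inr ⟨h1, h2⟩)).ne h
    · exact (rankBy_lt_of_lt f (.inr ⟨h1.symm, h2⟩)).ne' h
  · exact (rankBy_lt_of_lt f (.inl h1)).ne' h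

theorem rankBy_lt (f : Fin n → Fin m) (v : Fin n) : rankBy f v < n := by
  have : rankBy f v < (Finset.univ : Finset (Fin n)).card := by
    apply Finset.card_lt_card
    rw [Finset.ssubset_iff_of_subset (Finset.subset_univ _)]
    exact ⟨v, Finset.mem_univ _, by simp⟩
  simpa using this

/-- A refinement of `f` whose fibres have at most `t` elements. -/
def refine (t : ℕ) (f : Fin n → Fin m) (v : Fin n) : ℕ :=
  f v + rankBy f v / t

/-- In the order that defines the rank, both summands of `refine` are nondecreasing, and the first
one jumps whenever `f` does. Hence refining only separates nodes and never merges fibres of `f`. -/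
theorem eq_of_refine_eq {t : ℕ} {f : Fin n → Fin m} {u v : Fin n}
    (h : refine t f u = refine t f v) : f u = f v := by
  unfold refine at h
  rcases lt_trichotomy (f u) (f v) with h1 | h1 | h1
  · have := Nat.div_le_div_right (c := t) (rankBy_lt_of_lt f (.inl h1)).le
    omega
  · exact h1
  · have := Nat.div_le_div_right (c := t) (rankBy_lt_of_lt f (.inl h1)).le
    omega

theorem refine_lt {t : ℕ} (hm : n ≤ m * t) (f : Fin n → Fin m) (v : Fin n) :
    refine t f v < 2 * m := by
  have h1 : rankBy f v / t < m :=
    Nat.div_lt_of_lt_mul ((rankBy_lt f v).trans_le (hm.trans_eq (mul_comm _ _)))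
  have := (f v).isLt
  unfold refine
  omega

/-- On a fibre both `f` and the quotient `rankBy f v / t` are constant, so the remainder modulo `t`
determines the rank and thereby the node. -/
theorem card_refine_fiber_le {t : ℕ} (ht : 0 < t) (f : Fin n → Fin m) (b : ℕ) :
    (Finset.univ.filter fun v => refine t f v = b).card ≤ t := by
  refine le_of_le_of_eq (b := (Finset.range t).card) ?_ (Finset.card_range t)
  apply Finset.card_le_card_of_injOn fun v => rankBy f v % t
  · intro v _
    simpa using Nat.mod_lt _ ht
  · intro u hu v hv h
    simp only [Finset.coe_filter, Finset.mem_univ, true_and, Set.mem_ofPred_eq] at hu hv h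
    have h1 : f u = f v := eq_of_refine_eq (hu.trans hv.symm)
    have h2 : rankBy f u / t = rankBy f v / t := by
      unfold refine at hu hv
      rw [h1] at hu
      omega
    apply rankBy_injective f
    rw [← Nat.div_add_mod (rankBy f u) t, ← Nat.div_add_mod (rankBy f v) t, h2]
    simp only [h]

end Refine

/-! ### The probability of a core -/

section Core

/-- Every element of `S` shares its value under `f` with another element of `S`. -/
def IsCore {ι κ : Type*} (f : ι → κ) (S : Finset ι) : Prop :=
  ∀ v ∈ S, ∃ w ∈ S, w ≠ v ∧ f w = f v

variable {ι κ : Type*} [DecidableEq ι] [DecidableEq κ]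

theorem IsCore.two_mul_card_image_le {f : ι → κ} {S : Finset ι} (h : IsCore f S) :
    2 * (S.image f).card ≤ S.card := by
  apply Finset.mul_card_image_le_card
  intro b hb
  obtain ⟨v, hv, rfl⟩ := Finset.mem_image.1 hb
  obtain ⟨w, hw, hne, hf⟩ := h v hv
  have : ({w, v} : Finset ι) ⊆ S.filter fun a => f a = f v := by
    intro x hx
    simp only [Finset.mem_insert, Finset.mem_singleton] at hx
    rcases hx with rfl | rfl <;> simp [*]
  exact (Finset.card_pair hne).symm.le.trans (Finset.card_le_card this)

variable [Fintype ι] [Fintype κ]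

open Classical in
-- The image of a core has at most half as many elements as the core. The count is a union bound
-- over the sets of exactly `S.card / 2` values that may contain this image; outside `S` the
-- function is free.
theorem card_isCore_le (S : Finset ι) (hS : S.card ≤ Fintype.card κ) :
    (Finset.univ.filter fun f : ι → κ => IsCore f S).card ≤
      (Fintype.card κ).choose (S.card / 2) * ((S.card / 2) ^ S.card *
        Fintype.card κ ^ (Fintype.card ι - S.card)) := by
  have h : (Finset.univ.filter fun f : ι → κ => IsCore f S) ⊆
      (Finset.powersetCard (S.card / 2) (Finset.univ : Finset κ)).biUnion fun T =>
        Fintype.piFinset fun v => if v ∈ S then T else Finset.univ := by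
    intro f hf
    have hf' : IsCore f S := by simpa using hf
    have h1 : (S.image f).card ≤ S.card / 2 := by
      have := hf'.two_mul_card_image_le
      omega
    obtain ⟨T, hT, hc⟩ := Finset.exists_superset_card_eq h1
      ((Nat.div_le_self _ _).trans hS)
    simp only [Finset.mem_biUnion, Finset.mem_powersetCard, Finset.subset_univ, true_and]
    refine ⟨T, hc, ?_⟩
    rw [Fintype.mem_piFinset]
    intro v
    split_ifs with hv
    · exact hT (Finset.mem_image_of_mem f hv)
    · exact Finset.mem_univ _
  refine (Finset.card_le_card h).trans ((Finset.card_biUnion_le_card_mul _ _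
    ((S.card / 2) ^ S.card * Fintype.card κ ^ (Fintype.card ι - S.card)) ?_).trans_eq ?_)
  · intro T hT
    rw [Fintype.card_piFinset]
    have hc := (Finset.mem_powersetCard.1 hT).2
    apply le_of_eq
    rw [← Finset.prod_mul_prod_compl S]
    congr 1
    · rw [Finset.prod_congr rfl fun v hv => by rw [if_pos hv]]
      simp [hc]
    · rw [Finset.prod_congr rfl fun v hv => by rw [if_neg (Finset.mem_compl.1 hv)]]
      simp [Finset.card_compl]
  · rw [Finset.card_powersetCard, Finset.card_univ]

/-- A weak Stirling bound: `q ^ q / q!` is a term of the series of `exp q`, and `e < 3`. -/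
theorem pow_self_le_three_pow_mul_factorial (q : ℕ) :
    (q : ℝ) ^ q ≤ 3 ^ q * (q.factorial : ℝ) := by
  have h := Real.pow_div_factorial_le_exp (q : ℝ) (Nat.cast_nonneg q) q
  have h2 : Real.exp q ≤ 3 ^ q := by
    rw [← mul_one (q : ℝ), Real.exp_nat_mul]
    exact pow_le_pow_left₀ (Real.exp_pos _).le (by linarith [Real.exp_one_lt_d9]) _
  rw [div_le_iff₀ (by positivity)] at h
  exact h.trans (mul_le_mul_of_nonneg_right h2 (by positivity))

/-- The fourth power of the probability that a random function has the core `S`. -/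
theorem choose_mul_pow_le {m s : ℕ} (hs : s ≤ m) (hm : 0 < m) :
    ((m.choose (s / 2) : ℝ) * ((s / 2 : ℕ) : ℝ) ^ s / (m : ℝ) ^ s) ^ 4 ≤
      (9 / 4 * (s / m : ℝ) ^ 2) ^ s := by
  set q := s / 2 with hq
  have hm' : (0 : ℝ) < m := by exact_mod_cast hm
  have hx0 : (0 : ℝ) ≤ q / m := by positivity
  have hx1 : (q / m : ℝ) ≤ 1 := by
    rw [div_le_one hm']; exact_mod_cast (Nat.div_le_self s 2).trans hs
  have hx2 : (q / m : ℝ) ≤ (s / m : ℝ) / 2 := by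
    rw [div_div, mul_comm (m : ℝ), ← div_div]
    apply div_le_div_of_nonneg_right _ hm'.le
    rw [le_div_iff₀ (by norm_num)]
    exact_mod_cast Nat.div_mul_le_self s 2
  have h1 : (m.choose q : ℝ) * (q : ℝ) ^ q ≤ 3 ^ q * (m : ℝ) ^ q := by
    have := Nat.choose_le_pow_div (α := ℝ) q m
    have h3 := pow_self_le_three_pow_mul_factorial q
    calc (m.choose q : ℝ) * (q : ℝ) ^ q
        ≤ ((m : ℝ) ^ q / q.factorial) * (3 ^ q * q.factorial) := by gcongr
      _ = 3 ^ q * (m : ℝ) ^ q := by field_simp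
  -- Of the `s` factors `q / m`, `q` are spent on the binomial coefficient.
  have h2 : (m.choose q : ℝ) * (q : ℝ) ^ s / (m : ℝ) ^ s ≤ 3 ^ q * (q / m : ℝ) ^ (s - q) := by
    have hsq : s = q + (s - q) := by omega
    rw [div_le_iff₀ (by positivity)]
    calc (m.choose q : ℝ) * (q : ℝ) ^ s
        = (m.choose q : ℝ) * (q : ℝ) ^ q * (q : ℝ) ^ (s - q) := by
          rw [mul_assoc, ← pow_add, ← hsq]
      _ ≤ 3 ^ q * (m : ℝ) ^ q * (q : ℝ) ^ (s - q) := by gcongr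
      _ = 3 ^ q * (q / m : ℝ) ^ (s - q) * (m : ℝ) ^ s := by
          conv_rhs => rw [hsq, pow_add, Nat.add_sub_cancel_left, div_pow]
          field_simp
  calc _ ≤ (3 ^ q * (q / m : ℝ) ^ (s - q)) ^ 4 := by gcongr
    _ = 3 ^ (4 * q) * (q / m : ℝ) ^ (4 * (s - q)) := by
        rw [mul_pow, ← pow_mul, ← pow_mul, mul_comm q, mul_comm (s - q)]
    -- Since `q ≤ s / 2`, the exponents satisfy `4 * q ≤ 2 * s` and `4 * (s - q) ≥ 2 * s`; the base
    -- `q / m` is at most `1`.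
    _ ≤ 3 ^ (2 * s) * (q / m : ℝ) ^ (2 * s) := by
        apply mul_le_mul _ _ (by positivity) (by positivity)
        · exact pow_le_pow_right₀ (by norm_num) (by omega)
        · exact pow_le_pow_of_le_one hx0 hx1 (by omega)
    _ ≤ 3 ^ (2 * s) * ((s / m : ℝ) / 2) ^ (2 * s) := by gcongr
    _ = (9 / 4 * (s / m : ℝ) ^ 2) ^ s := by
        rw [← mul_pow, pow_mul]; congr 1; ring

/-- Since `k.choose s ≤ (3 k / s) ^ s`, one of the two factors `(s / m) ^ s` turns the binomial
coefficient into a power of the small number `k / m`, and the other one supplies the factor `1 / m`.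
Four hash functions provide both. The term `s = 0` is set to zero because the empty set is trivially
a core and is not an obstruction. -/
theorem sum_choose_mul_pow_le {m k : ℕ} (hm : 0 < m) (hk : 100 * k ≤ m) :
    ∑ s ∈ Finset.range (k + 1), (k.choose s : ℝ) *
      (if s = 0 then 0 else (9 / 4 * (s / m : ℝ) ^ 2) ^ s) ≤ 1 / m := by
  have hm' : (0 : ℝ) < m := by exact_mod_cast hm
  have hterm : ∀ s ∈ Finset.range (k + 1), (k.choose s : ℝ) *
      (if s = 0 then 0 else (9 / 4 * (s / m : ℝ) ^ 2) ^ s) ≤ (1 / m) * ((1 / 2) ^ s / 2) := by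
    intro s hs
    rcases Nat.eq_zero_or_pos s with rfl | hs0
    · simp
    rw [if_neg hs0.ne']
    have hsk : s ≤ k := by simpa [Nat.lt_succ_iff] using hs
    have hs' : (0 : ℝ) < s := by exact_mod_cast hs0
    have hkm : (k / m : ℝ) ≤ 1 / 100 := by
      rw [div_le_div_iff₀ hm' (by norm_num)]
      have : (100 * k : ℝ) ≤ m := by exact_mod_cast hk
      linarith
    have hsm : (s / m : ℝ) ≤ 1 := by
      rw [div_le_one hm']; exact_mod_cast (by omega : s ≤ m)
    have h1 : (k.choose s : ℝ) ≤ (3 * k / s : ℝ) ^ s := by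
      have h2 := Nat.choose_le_pow_div (α := ℝ) s k
      have h3 := pow_self_le_three_pow_mul_factorial s
      refine h2.trans ?_
      rw [div_pow, mul_pow, div_le_div_iff₀ (by positivity) (by positivity)]
      calc (k : ℝ) ^ s * (s : ℝ) ^ s ≤ (k : ℝ) ^ s * (3 ^ s * (s.factorial : ℝ)) := by gcongr
        _ = _ := by ring
    calc (k.choose s : ℝ) * (9 / 4 * (s / m : ℝ) ^ 2) ^ s
        ≤ (3 * k / s : ℝ) ^ s * (9 / 4 * (s / m : ℝ) ^ 2) ^ s := by gcongr
      _ = (27 / 4 * (k / m : ℝ)) ^ s * (s / m : ℝ) ^ s := by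
          rw [← mul_pow, ← mul_pow]; congr 1; field_simp; ring
      -- Here `27 / 4 * (1 / 100) ≤ 1 / 8`, and of `(s / m) ^ s` only one factor is kept.
      _ ≤ (1 / 8) ^ s * (s / m : ℝ) := by
          gcongr
          · linarith
          · exact pow_le_of_le_one (by positivity) hsm hs0.ne'
      _ = (1 / m) * ((1 / 8) ^ s * s) := by ring
      _ ≤ (1 / m) * ((1 / 2) ^ s / 2) := by
          gcongr
          have h4 : (2 * s : ℝ) ≤ 4 ^ s := by
            have h5 : s < 2 ^ s := Nat.lt_two_pow_self
            have h6 : (2 : ℕ) ≤ 2 ^ s := by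
              calc 2 = 2 ^ 1 := rfl
                _ ≤ 2 ^ s := Nat.pow_le_pow_right (by norm_num) hs0
            have h7 : (4 : ℕ) ^ s = 2 ^ s * 2 ^ s := by rw [← mul_pow]; rfl
            have : 2 * s ≤ 4 ^ s := by rw [h7]; exact Nat.mul_le_mul h6 h5.le
            exact_mod_cast this
          have h8 : ((1 / 2 : ℝ)) ^ s = (1 / 8) ^ s * 4 ^ s := by
            rw [← mul_pow]; norm_num
          rw [h8, mul_div_assoc]
          gcongr
          linarith
  refine (Finset.sum_le_sum hterm).trans ?_
  rw [← Finset.mul_sum, ← Finset.sum_div]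
  have := sum_geometric_two_le (k + 1)
  refine mul_le_of_le_one_right (by positivity) ?_
  linarith

open Classical in
-- The four hash functions are independent, so the functions for which a given `S` is a core of all
-- four form a product set; the bound is then summed over the subsets `S` of `K`, grouped by
-- cardinality.
theorem card_exists_isCore_le {m : ℕ} (hm : 0 < m) (K : Finset ι) (hK : 100 * K.card ≤ m) :
    ((Finset.univ.filter fun f : Fin 4 → ι → Fin m =>
        ∃ S ⊆ K, S.Nonempty ∧ ∀ h, IsCore (f h) S).card : ℝ) ≤
      1 / m * (Fintype.card (Fin 4 → ι → Fin m) : ℝ) := by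
  have hm' : (0 : ℝ) < m := by exact_mod_cast hm
  have hsub : (Finset.univ.filter fun f : Fin 4 → ι → Fin m =>
        ∃ S ⊆ K, S.Nonempty ∧ ∀ h, IsCore (f h) S) ⊆
      (K.powerset.filter (·.Nonempty)).biUnion fun S =>
        Fintype.piFinset fun _ : Fin 4 => Finset.univ.filter fun g : ι → Fin m => IsCore g S := by
    intro f hf
    simp only [Finset.mem_filter, Finset.mem_univ, true_and] at hf
    obtain ⟨S, h1, h2, h3⟩ := hf
    simp only [Finset.mem_biUnion, Finset.mem_filter, Finset.mem_powerset, Fintype.mem_piFinset,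
      Finset.mem_univ, true_and]
    exact ⟨S, ⟨h1, h2⟩, h3⟩
  have hcard : (Fintype.card (Fin 4 → ι → Fin m) : ℝ) = ((m : ℝ) ^ Fintype.card ι) ^ 4 := by
    simp
  have hone : ∀ S ⊆ K, S.Nonempty →
      ((Fintype.piFinset fun _ : Fin 4 =>
        Finset.univ.filter fun g : ι → Fin m => IsCore g S).card : ℝ) ≤
      (if S.card = 0 then 0 else (9 / 4 * (S.card / m : ℝ) ^ 2) ^ S.card) *
        ((m : ℝ) ^ Fintype.card ι) ^ 4 := by
    intro S hS hne
    rw [if_neg (Finset.card_pos.2 hne).ne', Fintype.card_piFinset]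
    have hSm : S.card ≤ m := by have := Finset.card_le_card hS; omega
    have h1 := card_isCore_le (κ := Fin m) S (by simpa using hSm)
    rw [Fintype.card_fin] at h1
    have h2 : ((Finset.univ.filter fun g : ι → Fin m => IsCore g S).card : ℝ) ≤
        ((m.choose (S.card / 2) : ℝ) * ((S.card / 2 : ℕ) : ℝ) ^ S.card / (m : ℝ) ^ S.card) *
          (m : ℝ) ^ Fintype.card ι := by
      have h3 : Fintype.card ι = S.card + (Fintype.card ι - S.card) := by
        have := Finset.card_le_univ S; omega
      have h4 : (m : ℝ) ^ Fintype.card ι =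
          (m : ℝ) ^ S.card * (m : ℝ) ^ (Fintype.card ι - S.card) := by
        rw [← pow_add, ← h3]
      refine (Nat.cast_le.2 h1).trans_eq ?_
      rw [h4]
      push_cast
      generalize (m : ℝ) ^ (Fintype.card ι - S.card) = y
      generalize ((S.card / 2 : ℕ) : ℝ) ^ S.card = z
      field_simp
    simp only [Finset.prod_const, Finset.card_univ, Fintype.card_fin]
    push_cast
    refine (pow_le_pow_left₀ (by positivity) h2 4).trans ?_
    rw [mul_pow]
    exact mul_le_mul_of_nonneg_right (choose_mul_pow_le hSm hm) (by positivity)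
  rw [hcard]
  calc _ ≤ ((∑ S ∈ K.powerset.filter (·.Nonempty), (Fintype.piFinset fun _ : Fin 4 =>
        Finset.univ.filter fun g : ι → Fin m => IsCore g S).card : ℕ) : ℝ) :=
        Nat.cast_le.2 ((Finset.card_le_card hsub).trans Finset.card_biUnion_le)
    _ ≤ ∑ S ∈ K.powerset.filter (·.Nonempty),
        (if S.card = 0 then 0 else (9 / 4 * (S.card / m : ℝ) ^ 2) ^ S.card) *
        ((m : ℝ) ^ Fintype.card ι) ^ 4 := by
        rw [Nat.cast_sum]
        apply Finset.sum_le_sum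
        intro S hS
        rw [Finset.mem_filter, Finset.mem_powerset] at hS
        exact hone S hS.1 hS.2
    _ ≤ ∑ S ∈ K.powerset,
        (if S.card = 0 then 0 else (9 / 4 * (S.card / m : ℝ) ^ 2) ^ S.card) *
        ((m : ℝ) ^ Fintype.card ι) ^ 4 := by
        apply Finset.sum_le_sum_of_subset_of_nonneg (Finset.filter_subset _ _)
        intro S _ _
        split_ifs <;> positivity
    _ = (∑ s ∈ Finset.range (K.card + 1), (K.card.choose s : ℝ) *
        (if s = 0 then 0 else (9 / 4 * (s / m : ℝ) ^ 2) ^ s)) *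
        ((m : ℝ) ^ Fintype.card ι) ^ 4 := by
        rw [← Finset.sum_mul, Finset.sum_powerset_apply_card (fun s : ℕ =>
          if s = 0 then (0 : ℝ) else (9 / 4 * (s / m : ℝ) ^ 2) ^ s)]
        simp only [nsmul_eq_mul]
    _ ≤ _ := mul_le_mul_of_nonneg_right (sum_choose_mul_pow_le hm hK) (by positivity)

end Core

/-! ### The probability of a false identification -/

section Mixture

variable {ι κ σ : Type*} [Fintype ι] [DecidableEq ι] [Fintype κ] [DecidableEq κ] [Fintype σ]

open Classical in
-- As `A` has two elements, it contains some `a ≠ u`. Once the digits of all other nodes are fixed,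
-- each equation determines the digit of `a`, because its coefficient `d a` is nonzero and `a` does
-- not occur on the right. So restriction to the other nodes is injective on the bad choices.
theorem card_mixture_eq_le (x : σ → ℝ) (hx : Function.Injective x) (d : ι → ℝ) (A : Finset ι)
    (hA : 2 ≤ A.card) (hd : ∀ v ∈ A, d v ≠ 0) (u : ι) :
    (Finset.univ.filter fun w : ι → κ → σ =>
        ∀ j, ∑ v ∈ A, x (w v j) * d v = x (w u j) * ∑ v ∈ A, d v).card *
      Fintype.card σ ^ Fintype.card κ ≤ Fintype.card (ι → κ → σ) := by
  obtain ⟨a, ha, hau⟩ : ∃ a ∈ A, a ≠ u := by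
    by_contra h
    push Not at h
    have : A.card ≤ 1 := Finset.card_le_one.2 fun a ha b hb => (h a ha).trans (h b hb).symm
    omega
  have h1 : (Finset.univ.filter fun w : ι → κ → σ =>
        ∀ j, ∑ v ∈ A, x (w v j) * d v = x (w u j) * ∑ v ∈ A, d v).card ≤
      Fintype.card ({v // v ≠ a} → κ → σ) := by
    rw [← Finset.card_univ]
    apply Finset.card_le_card_of_injOn fun w v => w v.1
    · intro w _; simp
    · intro w hw w' hw' h
      simp only [Finset.coe_filter, Finset.mem_univ, true_and, Set.mem_ofPred_eq] at hw hw'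
      have hoff : ∀ v, v ≠ a → w v = w' v := fun v hv => congrFun h ⟨v, hv⟩
      funext v
      by_cases hv : v = a
      · subst hv
        funext j
        have e1 := hw j
        have e2 := hw' j
        rw [← Finset.add_sum_erase A _ ha] at e1 e2
        rw [hoff u hau.symm] at e1
        rw [Finset.sum_congr rfl fun y hy => by rw [hoff y (Finset.ne_of_mem_erase hy)]] at e1
        have e3 : x (w v j) * d v = x (w' v j) * d v := by linarith
        exact hx (mul_right_cancel₀ (hd v ha) e3)
      · exact hoff v hv
  calc _ ≤ Fintype.card ({v // v ≠ a} → κ → σ) * Fintype.card σ ^ Fintype.card κ :=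
        Nat.mul_le_mul_right _ h1
    _ = _ := by
        have h2 : Fintype.card {v // v ≠ a} + 1 = Fintype.card ι := by
          have := Fintype.card_subtype_compl (fun v => v = a)
          have h3 : 0 < Fintype.card ι := Fintype.card_pos_iff.2 ⟨a⟩
          rw [Fintype.card_subtype_eq] at this
          simp only [ne_eq]
          omega
        rw [Fintype.card_fun, Fintype.card_fun (α := ι), Fintype.card_fun (α := κ), ← pow_succ, h2]

end Mixture

/-! ### Peeling -/

section Peeling

/-- A node is hashed to the four buckets `bucket v 0, …, bucket v 3`. -/
def Touches {n : ℕ} (bucket : Fin n → ℕ → ℕ) (v : Fin n) (b : ℕ) : Prop :=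
  ∃ h < 4, bucket v h = b

/-- A state of the peeling process: the nodes which are still to be found, and the queue of the
buckets to be inspected. -/
@[ext] structure PeelState (n : ℕ) where
  rest : Finset (Fin n)
  queue : ℕ → ℕ
  tail : ℕ

variable {n : ℕ} (N : ℕ) (bucket : Fin n → ℕ → ℕ)

open Classical in
/-- The nodes in the bucket `b` which are still to be found. -/
noncomputable def PeelState.members (S : PeelState n) (b : ℕ) : Finset (Fin n) :=
  S.rest.filter fun v => Touches bucket v b

/-- The bucket inspected in step `i`; the first `N` steps inspect all buckets in turn. -/
def PeelState.current (S : PeelState n) (i : ℕ) : ℕ :=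
  if i < N then i else S.queue i

/-- The node `v` has been found: its buckets are to be inspected again. -/
def PeelState.remove (S : PeelState n) (v : Fin n) : PeelState n where
  rest := S.rest.erase v
  queue p := if S.tail ≤ p ∧ p < S.tail + 4 then bucket v (p - S.tail) else S.queue p
  tail := S.tail + 4

open Classical in
/-- One step: a node that is alone in the bucket which is inspected is found. -/
noncomputable def peelStep (i : ℕ) (S : PeelState n) : PeelState n :=
  if h : (S.members bucket (S.current N i)).card = 1 then
    S.remove bucket (Classical.choose (Finset.card_eq_one.1 h))
  else S

theorem peelStep_of_eq_singleton {i : ℕ} {S : PeelState n} {v : Fin n}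
    (h : S.members bucket (S.current N i) = {v}) :
    peelStep N bucket i S = S.remove bucket v := by
  have h1 : (S.members bucket (S.current N i)).card = 1 := by simp [h]
  have h2 := Classical.choose_spec (Finset.card_eq_one.1 h1)
  rw [peelStep, dif_pos h1]
  congr 1
  exact (Finset.singleton_injective (h.symm.trans h2)).symm

theorem peelStep_of_card_ne_one {i : ℕ} {S : PeelState n}
    (h : (S.members bucket (S.current N i)).card ≠ 1) : peelStep N bucket i S = S := by
  rw [peelStep, dif_neg h]

/-- The state before step `i`, when the nodes in `K` are to be found. -/
noncomputable def peel (K : Finset (Fin n)) : ℕ → PeelState n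
  | 0 => ⟨K, fun _ => 0, N⟩
  | i + 1 => peelStep N bucket i (peel K i)

/-- What is invariant while peeling: buckets with exactly one node wait in the queue. -/
structure PeelInvariant (K : Finset (Fin n)) (i : ℕ) (S : PeelState n) : Prop where
  subset : S.rest ⊆ K
  tail_eq : S.tail + 4 * S.rest.card = N + 4 * K.card
  queue_lt : ∀ p, S.queue p < N
  pending : ∀ b, (S.members bucket b).card = 1 → ∃ p, i ≤ p ∧ p < S.tail ∧ S.current N p = b

variable {N bucket}

theorem PeelState.mem_members {S : PeelState n} {b : ℕ} {v : Fin n} :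
    v ∈ S.members bucket b ↔ v ∈ S.rest ∧ Touches bucket v b := by
  simp [PeelState.members]

theorem PeelInvariant.current_lt {K : Finset (Fin n)} {i : ℕ} {S : PeelState n}
    (hS : PeelInvariant N bucket K i S) (p : ℕ) : S.current N p < N := by
  unfold PeelState.current
  split_ifs with h
  · exact h
  · exact hS.queue_lt p

/-- When `v` is found, the buckets touching `v` are enqueued afresh, and all other buckets keep
their nodes. The slot of such an untouched bucket cannot be slot `i`, whose bucket contains `v`.
When nothing is found, slot `i` is lost, but its bucket does not have exactly one node. -/
theorem PeelInvariant.step (hb : ∀ v h, h < 4 → bucket v h < N) {K : Finset (Fin n)} {i : ℕ}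
    {S : PeelState n} (hS : PeelInvariant N bucket K i S) :
    PeelInvariant N bucket K (i + 1) (peelStep N bucket i S) := by
  by_cases hc : (S.members bucket (S.current N i)).card = 1
  · obtain ⟨v, hv⟩ := Finset.card_eq_one.1 hc
    rw [peelStep_of_eq_singleton N bucket hv]
    have hvm : v ∈ S.members bucket (S.current N i) := by simp [hv]
    have hvR := (PeelState.mem_members.1 hvm).1
    have hcard := Finset.card_erase_add_one hvR
    have htail := hS.tail_eq
    have hRK := Finset.card_le_card hS.subset
    refine ⟨(Finset.erase_subset _ _).trans hS.subset, ?_, ?_, ?_⟩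
    · simp only [PeelState.remove]; omega
    · intro p
      simp only [PeelState.remove]
      split_ifs with h
      · exact hb _ _ (by omega)
      · exact hS.queue_lt p
    · intro b hbm
      by_cases ht : Touches bucket v b
      · obtain ⟨h, h4, rfl⟩ := ht
        refine ⟨S.tail + h, ?_, by simp only [PeelState.remove]; omega, ?_⟩
        · obtain ⟨p, h1, h2, -⟩ := hS.pending _ hc
          omega
        · have hN : ¬ S.tail + h < N := by omega
          simp only [PeelState.current, PeelState.remove, if_neg hN]
          rw [if_pos (by omega), Nat.add_sub_cancel_left]
      · have hsame : (S.remove bucket v).members bucket b = S.members bucket b := by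
          ext x
          simp only [PeelState.mem_members, PeelState.remove, Finset.mem_erase]
          constructor
          · rintro ⟨⟨-, h1⟩, h2⟩; exact ⟨h1, h2⟩
          · rintro ⟨h1, h2⟩
            refine ⟨⟨?_, h1⟩, h2⟩
            rintro rfl
            exact ht h2
        rw [hsame] at hbm
        obtain ⟨p, h1, h2, h3⟩ := hS.pending b hbm
        refine ⟨p, ?_, by simp only [PeelState.remove]; omega, ?_⟩
        · rcases h1.eq_or_lt with rfl | h1
          · exact absurd (PeelState.mem_members.1 (h3 ▸ hvm)).2 ht
          · exact h1
        · rw [← h3]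
          simp only [PeelState.current, PeelState.remove]
          rw [if_neg (c := S.tail ≤ p ∧ p < S.tail + 4) (by omega)]
  · rw [peelStep_of_card_ne_one N bucket hc]
    refine ⟨hS.subset, hS.tail_eq, hS.queue_lt, fun b hbm => ?_⟩
    obtain ⟨p, h1, h2, h3⟩ := hS.pending b hbm
    refine ⟨p, ?_, h2, h3⟩
    rcases h1.eq_or_lt with rfl | h1
    · exact absurd (h3 ▸ hbm) hc
    · exact h1

theorem peelInvariant_peel (hN : 0 < N) (hb : ∀ v h, h < 4 → bucket v h < N)
    (K : Finset (Fin n)) (i : ℕ) : PeelInvariant N bucket K i (peel N bucket K i) := by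
  induction i with
  | zero =>
    refine ⟨subset_rfl, rfl, fun _ => hN, fun b hbm => ?_⟩
    obtain ⟨v, hv⟩ := Finset.card_pos.1 (hbm.symm ▸ Nat.one_pos)
    obtain ⟨h, h4, rfl⟩ := (PeelState.mem_members.1 hv).2
    exact ⟨bucket v h, Nat.zero_le _, hb v h h4, by simp [PeelState.current, hb v h h4]⟩
  | succ i ih => exact ih.step hb

/-- If no set of nodes is a core, then peeling finds all nodes. -/
theorem rest_peel_eq_empty (hN : 0 < N) (hb : ∀ v h, h < 4 → bucket v h < N)
    (hdisj : ∀ v w h h', h < 4 → h' < 4 → bucket v h = bucket w h' → h = h')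
    {K : Finset (Fin n)}
    (hcore : ¬ ∃ S ⊆ K, S.Nonempty ∧ ∀ h < 4, IsCore (fun v => bucket v h) S)
    {i : ℕ} (hi : N + 4 * K.card ≤ i) : (peel N bucket K i).rest = ∅ := by
  have hI := peelInvariant_peel hN hb K i
  by_contra hne
  apply hcore
  refine ⟨_, hI.subset, Finset.nonempty_iff_ne_empty.2 hne, fun h h4 v hv => ?_⟩
  by_contra halone
  push Not at halone
  have h1 : (peel N bucket K i).members bucket (bucket v h) = {v} := by
    ext x
    simp only [PeelState.mem_members, Finset.mem_singleton]
    constructor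
    · rintro ⟨hx, h', h4', e⟩
      by_contra hxv
      have : h' = h := hdisj _ _ _ _ h4' h4 e
      subst this
      exact halone x hx hxv e
    · rintro rfl
      exact ⟨hv, h, h4, rfl⟩
  obtain ⟨p, hp1, hp2, -⟩ := hI.pending (bucket v h) (by simp [h1])
  have := hI.tail_eq
  omega

end Peeling

/-! ### Total correctness of programs -/

section Runs

/-- The program `p` halts on `s` after at most `T` operations, and `Q` then holds. -/
def Runs (p : Program) (s : Memory) (T : ℕ) (Q : Memory → Prop) : Prop :=
  ∃ s' t, Exec p s s' t ∧ t ≤ T ∧ Q s'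

theorem Runs.mono {p : Program} {s : Memory} {T T' : ℕ} {Q Q' : Memory → Prop}
    (h : Runs p s T Q) (hT : T ≤ T') (hQ : ∀ s', Q s' → Q' s') : Runs p s T' Q' := by
  obtain ⟨s', t, h1, h2, h3⟩ := h
  exact ⟨s', t, h1, h2.trans hT, hQ s' h3⟩

theorem Runs.skip {s : Memory} {T : ℕ} {Q : Memory → Prop} (h : Q s) : Runs .skip s T Q :=
  ⟨s, 0, .skip s, Nat.zero_le _, h⟩

theorem Runs.assign {a : ℕ} {i e : Expr} {s : Memory} {T : ℕ} {Q : Memory → Prop}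
    (hT : i.cost + e.cost + 1 ≤ T) (h : Q (s.write a (i.eval s) (e.eval s))) :
    Runs (.assign a i e) s T Q :=
  ⟨_, _, .assign a i e s, hT, h⟩

theorem Runs.seq {p q : Program} {s : Memory} {T T' : ℕ} {P Q : Memory → Prop}
    (hp : Runs p s T P) (hq : ∀ s', P s' → Runs q s' T' Q) : Runs (.seq p q) s (T + T') Q := by
  obtain ⟨s', t, h1, h2, h3⟩ := hp
  obtain ⟨s'', t', h4, h5, h6⟩ := hq s' h3
  exact ⟨s'', t + t', .seq h1 h4, Nat.add_le_add h2 h5, h6⟩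

theorem Runs.ite {e f : Expr} {p q : Program} {s : Memory} {c T : ℕ} {Q : Memory → Prop}
    (hc : e.cost + f.cost + 1 ≤ c)
    (hp : e.eval s ≤ f.eval s → Runs p s T Q) (hq : ¬ e.eval s ≤ f.eval s → Runs q s T Q) :
    Runs (.ite e f p q) s (c + T) Q := by
  by_cases h : e.eval s ≤ f.eval s
  · obtain ⟨s', t, h1, h2, h3⟩ := hp h
    exact ⟨s', _, .iteTrue h h1, by omega, h3⟩
  · obtain ⟨s', t, h1, h2, h3⟩ := hq h
    exact ⟨s', _, .iteFalse h h1, by omega, h3⟩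

theorem Memory.read_natCast (s : Memory) (a j : ℕ) : s.read a (j : ℝ) = s a j := by
  rw [Memory.read, if_pos ⟨j, rfl⟩, Nat.floor_natCast]

theorem Memory.write_of_ne (s : Memory) {a b : ℕ} (h : b ≠ a) (x y : ℝ) :
    s.write a x y b = s b := by
  funext i
  rw [Memory.write, if_neg fun h' => h h'.1]

theorem Memory.write_natCast (s : Memory) (a j i : ℕ) (y : ℝ) :
    s.write a (j : ℝ) y a i = if i = j then y else s a i := by
  simp [Memory.write]

/-- A variable, stored in cell `0` of an array. -/
def var (a : ℕ) : Expr := .cell a (.lit 0)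

/-- Assignment to a variable. -/
def setVar (a : ℕ) (e : Expr) : Program := .assign a (.lit 0) e

theorem eval_var (s : Memory) (a : ℕ) : (var a).eval s = s a 0 :=
  Memory.read_natCast s a 0

theorem Runs.setVar {a : ℕ} {e : Expr} {s : Memory} {T : ℕ} {Q : Memory → Prop}
    (hT : e.cost + 2 ≤ T)
    (h : ∀ s' : Memory, (∀ b, b ≠ a → s' b = s b) → s' a 0 = e.eval s → Q s') :
    Runs (setVar a e) s T Q := by
  refine Runs.assign (by simp only [Expr.cost]; omega) (h _ (fun b hb => ?_) ?_)
  · exact Memory.write_of_ne s hb _ _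
  · simp [Expr.eval, Memory.write]

/-- The header of the table: every fifth cell. -/
def header (x : ℕ) : Expr := .cell 1 (.lit (5 * x))

theorem eval_header (s : Memory) (x : ℕ) : (header x).eval s = s 1 (5 * x) :=
  Memory.read_natCast s 1 (5 * x)

/-- Repeat `p` with the variable `c` running from `0` up to an entry of the header. -/
def forLoop (c x : ℕ) (p : Program) : Program :=
  .seq (setVar c (.lit 0)) (.loop (.plus (var c) (.lit 1)) (header x)
    (.seq p (setVar c (.plus (var c) (.lit 1)))))

/-- The invariant `I` must survive arbitrary changes of the counter's array, so it may not mention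
the counter. A round costs `B` for the body, `6` for the increment and `7` for the comparison; the
one extra round in the bound pays for the initialization and the last comparison. The test `c + 1 ≤
limit` expresses `c < limit` for natural numbers. -/
theorem Runs.forLoop {c x B K : ℕ} {p : Program} (I : ℕ → Memory → Prop) {s : Memory}
    (h0 : ∀ s', (∀ a, a ≠ c → s' a = s a) → I 0 s')
    (hK : ∀ i s, I i s → s 1 (5 * x) = K)
    (hstep : ∀ i < K, ∀ s, I i s → s c 0 = i → Runs p s B fun s' =>
      s' c 0 = s c 0 ∧ ∀ s'', (∀ a, a ≠ c → s'' a = s' a) → I (i + 1) s'') :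
    Runs (forLoop c x p) s ((B + 13) * (K + 1)) (I K) := by
  have key : ∀ m i s, i + m = K → I i s → s c 0 = i →
      Runs (.loop (.plus (var c) (.lit 1)) (header x)
        (.seq p (Tomography.setVar c (.plus (var c) (.lit 1))))) s ((B + 13) * m + 7) (I K) := by
    intro m
    induction m with
    | zero =>
      intro i s him hI hc
      refine ⟨s, _, .loopFalse ?_, (Nat.zero_add 7).symm.le, by rwa [← him]⟩
      rw [eval_header, hK i s hI]
      simp only [Expr.eval, eval_var, hc]
      push_cast [← him]
      linarith
    | succ m ih =>
      intro i s him hI hc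
      obtain ⟨s1, t1, h1, h2, h3, h4⟩ := hstep i (by omega) s hI hc
      obtain ⟨s2, t2, e1, e2, e3, e4⟩ : Runs (Tomography.setVar c (.plus (var c) (.lit 1))) s1 6
          fun s2 => (∀ b, b ≠ c → s2 b = s1 b) ∧ s2 c 0 = (i + 1 : ℕ) := by
        refine Runs.setVar le_rfl fun s' h h' => ⟨h, ?_⟩
        rw [h']
        simp only [Expr.eval, eval_var, h3, hc]
        push_cast; ring
      obtain ⟨s3, t3, f1, f2, f3⟩ := ih (i + 1) s2 (by omega) (h4 s2 e3) e4
      refine ⟨s3, _, .loopTrue ?_ (.seq h1 e1) f1, ?_, f3⟩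
      · rw [eval_header, hK i s hI]
        simp only [Expr.eval, eval_var, hc, ← him]
        push_cast; linarith [(Nat.cast_nonneg m : (0 : ℝ) ≤ m)]
      · have : (Expr.plus (var c) (.lit 1)).cost + (header x).cost + 1 = 7 := rfl
        rw [this]
        nlinarith
  refine (Runs.seq (Runs.setVar (T := 3) (by decide) fun s' h h' => And.intro h h')
    fun s' hs' => key K 0 s' (by omega) (h0 s' hs'.1) (by rw [hs'.2]; rfl)).mono ?_ fun _ h => h
  nlinarith

end Runs

/-! ### The table -/

/-- What the reconstruction has to know about a design. -/
structure Sketch (n : ℕ) where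
  numBuckets : ℕ
  numWeights : ℕ
  numDigits : ℕ
  base : ℕ
  numSteps : ℕ
  bucket : Fin n → ℕ → ℕ
  weight : Fin n → ℕ → ℕ
  gain : ℕ → ℕ
  loss : ℕ → ℕ

namespace Sketch

variable {n : ℕ} (K : Sketch n)

/-- The entries of the table: five interleaved arrays. -/
def entry (i : ℕ) : ℕ :=
  if i % 5 = 0 then
    if i / 5 = 0 then K.numBuckets
    else if i / 5 = 1 then K.numWeights
    else if i / 5 = 2 then K.numDigits
    else if i / 5 = 3 then K.base
    else if i / 5 = 4 then K.numSteps
    else if i / 5 = 5 then K.numBuckets * K.numWeights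
    else 0
  else if i % 5 = 1 then
    if h : i / 5 / 4 < n then K.bucket ⟨i / 5 / 4, h⟩ (i / 5 % 4) else 0
  else if i % 5 = 2 then
    if h : i / 5 < n * K.numWeights then
      K.weight ⟨i / 5 / K.numWeights, Nat.div_lt_of_lt_mul (mul_comm n _ ▸ h)⟩
        (i / 5 % K.numWeights)
    else 0
  else if i / 5 < K.numBuckets * K.numWeights then
    if i % 5 = 3 then K.gain (i / 5) else K.loss (i / 5)
  else 0

theorem entry_bucket (v : Fin n) {h : ℕ} (hh : h < 4) :
    K.entry (5 * (4 * v + h) + 1) = K.bucket v h := by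
  have h1 : (5 * (4 * (v : ℕ) + h) + 1) % 5 = 1 := by omega
  have h2 : (5 * (4 * (v : ℕ) + h) + 1) / 5 / 4 = v := by omega
  have h3 : (5 * (4 * (v : ℕ) + h) + 1) / 5 % 4 = h := by omega
  unfold entry
  simp only [h1, h2, h3, one_ne_zero, if_false, if_true, Fin.isLt, dif_pos, Fin.eta]

theorem entry_weight (v : Fin n) {j : ℕ} (hj : j < K.numWeights) :
    K.entry (5 * (v * K.numWeights + j) + 2) = K.weight v j := by
  have h1 : (5 * ((v : ℕ) * K.numWeights + j) + 2) % 5 = 2 := by omega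
  have h2 : (5 * ((v : ℕ) * K.numWeights + j) + 2) / 5 = v * K.numWeights + j := by omega
  have h3 : ((v : ℕ) * K.numWeights + j) / K.numWeights = v := by
    rw [mul_comm, Nat.mul_add_div (by omega), Nat.div_eq_of_lt hj, add_zero]
  have h4 : ((v : ℕ) * K.numWeights + j) % K.numWeights = j := by
    rw [mul_comm, Nat.mul_add_mod, Nat.mod_eq_of_lt hj]
  have h5 : (v : ℕ) * K.numWeights + j < n * K.numWeights := by
    have := Nat.mul_le_mul_right K.numWeights (Nat.succ_le_of_lt v.isLt)
    rw [Nat.succ_mul] at this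
    omega
  unfold entry
  simp [h1, h2, h3, h4, h5]

/-- The zero weights let the verification reject a natural number that names no node: the mixture
with all weights `1` would then have to vanish. -/
theorem entry_weight_of_le {u j : ℕ} (hu : n ≤ u) :
    K.entry (5 * (u * K.numWeights + j) + 2) = 0 := by
  have h1 : (5 * (u * K.numWeights + j) + 2) % 5 = 2 := by omega
  have h2 : (5 * (u * K.numWeights + j) + 2) / 5 = u * K.numWeights + j := by omega
  have h5 : ¬ u * K.numWeights + j < n * K.numWeights := by
    have := Nat.mul_le_mul_right K.numWeights hu
    omega
  unfold entry
  simp [h1, h2, h5]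

theorem entry_gain {x : ℕ} (hx : x < K.numBuckets * K.numWeights) :
    K.entry (5 * x + 3) = K.gain x := by
  have h1 : (5 * x + 3) % 5 = 3 := by omega
  have h2 : (5 * x + 3) / 5 = x := by omega
  unfold entry
  simp [h1, h2, hx]

theorem entry_loss {x : ℕ} (hx : x < K.numBuckets * K.numWeights) :
    K.entry (5 * x + 4) = K.loss x := by
  have h1 : (5 * x + 4) % 5 = 4 := by omega
  have h2 : (5 * x + 4) / 5 = x := by omega
  unfold entry
  simp [h1, h2, hx]

theorem entry_eq_zero {i : ℕ}
    (hi : 5 * (6 + 4 * n + n * K.numWeights + K.numBuckets * K.numWeights) ≤ i) :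
    K.entry i = 0 := by
  generalize hA : n * K.numWeights = A at hi
  generalize hB : K.numBuckets * K.numWeights = B at hi
  have h1 : ¬ i / 5 / 4 < n := by omega
  have h2 : ¬ i / 5 < A := by omega
  have h3 : ¬ i / 5 < B := by omega
  have h4 : 6 ≤ i / 5 := by omega
  unfold entry
  simp only [hA, hB, dif_neg h1, dif_neg h2, if_neg h3]
  split_ifs <;> omega

/-- The table as a list. -/
def table : List ℕ :=
  (List.range (5 * (6 + 4 * n + n * K.numWeights + K.numBuckets * K.numWeights))).map K.entry

theorem getD_table (i : ℕ) : K.table.getD i 0 = K.entry i := by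
  rw [table, List.getD_eq_getElem?_getD, List.getElem?_map]
  by_cases h : i < 5 * (6 + 4 * n + n * K.numWeights + K.numBuckets * K.numWeights)
  · rw [List.getElem?_range h]; rfl
  · rw [List.getElem?_eq_none (by simpa using h), K.entry_eq_zero (not_lt.1 h)]; rfl

/-- The table as it is stored in the memory. -/
def tableMemory (i : ℕ) : ℝ := (K.entry i : ℝ)

end Sketch

/-! ### The reconstruction program -/

section Programs

/-- Entry `x` of the `r`-th array of the table. -/
def tableAt (r : ℕ) (x : Expr) : Expr := .cell 1 (.plus (.times (.lit 5) x) (.lit r))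

/-- The index `b * J + j`, where `J` is the number of weights. -/
def pairIndex (b j : Expr) : Expr := .plus (.times b (header 1)) j

/-- The mixtures of the delays in each bucket are computed from the measurements. -/
def prepare : Program :=
  forLoop 7 5 (.assign 3 (var 7) (.plus
    (.minus (.cell 0 (.plus (.times (.lit 2) (var 7)) (.lit 1)))
      (.cell 0 (.plus (.times (.lit 2) (var 7)) (.lit 2))))
    (.times (.minus (tableAt 3 (var 7)) (tableAt 4 (var 7))) (.cell 0 (.lit 0)))))

/-- Variable `8` becomes the number whose digits are the ratios of the mixtures in the bucket. -/
def identify : Program :=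
  .seq (setVar 8 (.lit 0)) (forLoop 7 2 (setVar 8 (.plus (.times (var 8) (header 3))
    (.divided (.cell 3 (pairIndex (var 10) (.plus (var 7) (.lit 1)))) (var 12)))))

/-- Variable `9` becomes the deviation of the bucket from a bucket with the single node given by
variable `8`. -/
def verify : Program :=
  .seq (setVar 9 (.lit 0)) (forLoop 7 1 (.seq
    (setVar 14 (.minus (.cell 3 (pairIndex (var 10) (var 7)))
      (.times (tableAt 2 (pairIndex (var 8) (var 7))) (var 12))))
    (setVar 9 (.plus (var 9) (.times (var 14) (var 14))))))

/-- The node given by variable `8` is taken out of its `h`-th bucket, which is put on the queue. -/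
def takeOut (h : ℕ) : Program :=
  .seq (setVar 13 (tableAt 1 (.plus (.times (.lit 4) (var 8)) (.lit h)))) <|
  .seq (.assign 4 (var 6) (var 13)) <|
  .seq (setVar 6 (.plus (var 6) (.lit 1))) <|
  forLoop 7 1 (.assign 3 (pairIndex (var 13) (var 7))
    (.minus (.cell 3 (pairIndex (var 13) (var 7)))
      (.times (tableAt 2 (pairIndex (var 8) (var 7))) (var 12))))

/-- The delay of the node given by variable `8` is recorded. -/
def accept : Program :=
  .seq (.assign 2 (var 8) (var 12)) <|
  .seq (takeOut 0) <| .seq (takeOut 1) <| .seq (takeOut 2) (takeOut 3)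

/-- Inspection of the next bucket. Array `11` serves to check that variable `8` is a natural
number. -/
def inspect : Program :=
  .seq (.ite (.plus (var 5) (.lit 1)) (header 0) (setVar 10 (var 5))
    (setVar 10 (.cell 4 (var 5)))) <|
  .seq (setVar 12 (.cell 3 (pairIndex (var 10) (.lit 0)))) <|
  .seq identify <|
  .seq (.assign 11 (var 8) (.lit 1)) <|
  .seq verify <|
  .ite (.times (var 12) (var 12)) (.lit 0) .skip <|
  .ite (.lit 1) (.cell 11 (var 8)) (.ite (var 9) (.lit 0) accept .skip) .skip

/-- The reconstruction program. -/
def reconstruct : Program :=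
  .seq prepare (.seq (setVar 6 (header 0)) (forLoop 5 4 inspect))

end Programs

/-! ### Correctness and cost of the subroutines. -/

section Correctness

variable {n : ℕ} {K : Sketch n} {s : Memory}

theorem eval_header_table (hs : s 1 = K.tableMemory) (x : ℕ) :
    (header x).eval s = K.entry (5 * x) := by
  rw [eval_header, hs]; rfl

theorem eval_tableAt (hs : s 1 = K.tableMemory) {x : Expr} {k : ℕ} (hx : x.eval s = k) (r : ℕ) :
    (tableAt r x).eval s = K.entry (5 * k + r) := by
  have : (5 : ℕ) * x.eval s + (r : ℕ) = ((5 * k + r : ℕ) : ℝ) := by rw [hx]; push_cast; ring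
  simp only [tableAt, Expr.eval]
  rw [this, Memory.read_natCast, hs]; rfl

theorem eval_pairIndex (hs : s 1 = K.tableMemory) {b j : Expr} {b' j' : ℕ} (hb : b.eval s = b')
    (hj : j.eval s = j') : (pairIndex b j).eval s = (b' * K.numWeights + j' : ℕ) := by
  have : K.entry (5 * 1) = K.numWeights := by simp [Sketch.entry]
  simp only [pairIndex, Expr.eval, eval_header_table hs, hb, hj, this]
  push_cast; ring

theorem eval_cell {a k : ℕ} {x : Expr} (hx : x.eval s = k) : (Expr.cell a x).eval s = s a k := by
  simp only [Expr.eval]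
  rw [hx, Memory.read_natCast]

theorem eval_var_add_one {a k : ℕ} (h : s a 0 = k) :
    (Expr.plus (var a) (.lit 1)).eval s = (k + 1 : ℕ) := by
  simp only [Expr.eval, eval_var, h]; push_cast; ring

theorem pairIndex_inj {J b b' j j' : ℕ} (hj : j < J) (hj' : j' < J)
    (h : b * J + j = b' * J + j') : b = b' ∧ j = j' := by
  have h1 : j = j' := by
    have := congrArg (· % J) h
    simpa [Nat.mul_comm _ J, Nat.mul_add_mod, Nat.mod_eq_of_lt hj, Nat.mod_eq_of_lt hj'] using this
  subst h1
  exact ⟨Nat.eq_of_mul_eq_mul_right (by omega) (Nat.add_right_cancel h), rfl⟩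

theorem runs_prepare (hs : s 1 = K.tableMemory) :
    Runs prepare s (60 * (K.numBuckets * K.numWeights + 1)) fun s' =>
      (∀ a, a ≠ 3 → a ≠ 7 → s' a = s a) ∧ ∀ x < K.numBuckets * K.numWeights,
        s' 3 x = s 0 (2 * x + 1) - s 0 (2 * x + 2) + ((K.gain x : ℝ) - K.loss x) * s 0 0 := by
  have hlim : K.entry (5 * 5) = K.numBuckets * K.numWeights := by simp [Sketch.entry]
  refine (Runs.forLoop (B := 40) (K := K.numBuckets * K.numWeights)
    (fun i s' => (∀ a, a ≠ 3 → a ≠ 7 → s' a = s a) ∧ ∀ x < K.numBuckets * K.numWeights, x < i →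
        s' 3 x = s 0 (2 * x + 1) - s 0 (2 * x + 2) + ((K.gain x : ℝ) - K.loss x) * s 0 0)
    (fun s' h => ⟨fun a _ h7 => h a h7, fun x _ hx => absurd hx (Nat.not_lt_zero x)⟩)
    (fun i s' h => ?_) fun i hi s' h hc => Runs.assign (by decide) ⟨?_, fun s'' h'' => ⟨?_, ?_⟩⟩).mono
    (by omega) fun s' h => ⟨h.1, fun x hx => h.2 x hx hx⟩
  · rw [h.1 1 (by decide) (by decide), hs, Sketch.tableMemory, hlim]
  · rw [Memory.write_of_ne _ (by decide)]
  · intro a ha3 ha7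
    rw [h'' a ha7, Memory.write_of_ne _ ha3, h.1 a ha3 ha7]
  · intro x hx hxi
    have hs' : s' 1 = K.tableMemory := by rw [h.1 1 (by decide) (by decide), hs]
    have hv : (var 7).eval s' = i := by rw [eval_var, hc]
    rw [h'' 3 (by decide), hv, Memory.write_natCast]
    split_ifs with hxe
    · subst hxe
      have e1 : (Expr.plus (.times (.lit 2) (var 7)) (.lit 1)).eval s' = (2 * x + 1 : ℕ) := by
        simp only [Expr.eval, hv]; push_cast; ring
      have e2 : (Expr.plus (.times (.lit 2) (var 7)) (.lit 2)).eval s' = (2 * x + 2 : ℕ) := by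
        simp only [Expr.eval, hv]; push_cast; ring
      have e3 := eval_tableAt hs' hv 3
      have e4 := eval_tableAt hs' hv 4
      rw [K.entry_gain hx] at e3
      rw [K.entry_loss hx] at e4
      have e5 : (Expr.cell 0 (.lit 0)).eval s' = s' 0 0 := eval_var s' 0
      have e6 := eval_cell (a := 0) e1
      have e7 := eval_cell (a := 0) e2
      have e0 := h.1 0 (by decide) (by decide)
      rw [e0] at e5 e6 e7
      simp only [Expr.eval] at e3 e4 e5 e6 e7 ⊢
      rw [e3, e4, e5, e6, e7]
    · exact h.2 x hx (by omega)

/-- Horner's scheme, most significant digit first: after `i` rounds variable `8` holds the number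
formed by the leading `i` digits of `v`. The time bound and the frame condition hold for every
memory, the value only for a bucket with a single node. -/
theorem runs_identify (hs : s 1 = K.tableMemory) :
    Runs identify s (60 * (K.numDigits + 1)) fun s' =>
      (∀ a, a ≠ 7 → a ≠ 8 → s' a = s a) ∧ ∀ b v : ℕ, s 10 0 = b → s 12 0 ≠ 0 →
        (∀ j < K.numDigits, s 3 (b * K.numWeights + (j + 1)) =
          (v / K.base ^ (K.numDigits - 1 - j) % K.base : ℕ) * s 12 0) →
        v < K.base ^ K.numDigits → s' 8 0 = v := by
  have hlim : K.entry (5 * 2) = K.numDigits := by simp [Sketch.entry]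
  have hbase : K.entry (5 * 3) = K.base := by simp [Sketch.entry]
  refine (Runs.seq (T := 3) (Runs.setVar (by decide) fun s1 h1 h1' => And.intro h1 h1')
    fun s1 hs1 => Runs.forLoop (B := 30) (K := K.numDigits)
    (fun i s' => (∀ a, a ≠ 7 → a ≠ 8 → s' a = s a) ∧ ∀ b v : ℕ, s 10 0 = b → s 12 0 ≠ 0 →
        (∀ j < K.numDigits, s 3 (b * K.numWeights + (j + 1)) =
          (v / K.base ^ (K.numDigits - 1 - j) % K.base : ℕ) * s 12 0) →
        v < K.base ^ K.numDigits → s' 8 0 = (v / K.base ^ (K.numDigits - i) : ℕ))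
    (fun s' h => ⟨?_, ?_⟩)
    (fun i s' h => ?_) fun i hi s' h hc =>
      Runs.setVar (by decide) fun s2 h2 h2' => ⟨?_, fun s'' h'' => ⟨?_, ?_⟩⟩).mono
    (by omega) fun s' h => ⟨h.1, fun b v h10 h12 hj hv => ?_⟩
  · intro a h7 h8
    rw [h a h7, hs1.1 a h8]
  · intro b v _ _ _ hv
    rw [h 8 (by decide), hs1.2, Nat.sub_zero, Nat.div_eq_of_lt hv]
    rfl
  · rw [h.1 1 (by decide) (by decide), hs, Sketch.tableMemory, hlim]
  · rw [h2 7 (by decide)]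
  · intro a h7 h8
    rw [h'' a h7, h2 a h8, h.1 a h7 h8]
  · intro b v h10 h12 hj hv
    have hs' : s' 1 = K.tableMemory := by rw [h.1 1 (by decide) (by decide), hs]
    have hb : (var 10).eval s' = b := by rw [eval_var, h.1 10 (by decide) (by decide), h10]
    have e1 := eval_cell (a := 3) (eval_pairIndex hs' hb (eval_var_add_one hc))
    have e2 := eval_header_table hs' 3
    rw [hbase] at e2
    rw [h.1 3 (by decide) (by decide), hj i hi] at e1
    rw [h'' 8 (by decide), h2']
    simp only [Expr.eval] at e1 e2 ⊢
    rw [e1]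
    simp only [eval_var]
    rw [h.1 12 (by decide) (by decide), mul_div_cancel_right₀ _ h12, h.2 b v h10 h12 hj hv, e2]
    have e3 : K.numDigits - i = (K.numDigits - (i + 1)) + 1 := by omega
    have e4 : K.numDigits - 1 - i = K.numDigits - (i + 1) := by omega
    rw [e3, e4, pow_succ, ← Nat.div_div_eq_div_mul]
    norm_cast
    rw [mul_comm, Nat.div_add_mod]
  · rw [h.2 b v h10 h12 hj hv, Nat.sub_self, pow_zero, Nat.div_one]

/-- The deviation is a sum of squares, so a single comparison with zero tests all the equations at
once. -/
theorem runs_verify (hs : s 1 = K.tableMemory) :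
    Runs verify s (70 * (K.numWeights + 1)) fun s' =>
      (∀ a, a ≠ 7 → a ≠ 9 → a ≠ 14 → s' a = s a) ∧ ∀ b u : ℕ, s 10 0 = b → s 8 0 = u →
        s' 9 0 = ∑ j ∈ Finset.range K.numWeights, (s 3 (b * K.numWeights + j) -
          K.entry (5 * (u * K.numWeights + j) + 2) * s 12 0) ^ 2 := by
  have hlim : K.entry (5 * 1) = K.numWeights := by simp [Sketch.entry]
  refine (Runs.seq (T := 3) (Runs.setVar (by decide) fun s1 h1 h1' => And.intro h1 h1')
    fun s1 hs1 => Runs.forLoop (B := 50) (K := K.numWeights)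
    (fun i s' => (∀ a, a ≠ 7 → a ≠ 9 → a ≠ 14 → s' a = s a) ∧ ∀ b u : ℕ, s 10 0 = b → s 8 0 = u →
        s' 9 0 = ∑ j ∈ Finset.range i, (s 3 (b * K.numWeights + j) -
          K.entry (5 * (u * K.numWeights + j) + 2) * s 12 0) ^ 2)
    (fun s' h => ⟨?_, ?_⟩)
    (fun i s' h => ?_) fun i hi s' h hc => (Runs.seq (T := 35) (T' := 15)
      (Runs.setVar (by decide) fun s2 h2 h2' => And.intro h2 h2')
      fun s2 hs2 => Runs.setVar (by decide) fun s3 h3 h3' => ⟨?_, fun s'' h'' => ⟨?_, ?_⟩⟩)).mono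
    (by omega) fun s' h => h
  · intro a h7 h9 h14
    rw [h a h7, hs1.1 a h9]
  · intro b u _ _
    rw [h 9 (by decide), hs1.2]
    simp [Expr.eval]
  · rw [h.1 1 (by decide) (by decide) (by decide), hs, Sketch.tableMemory, hlim]
  · rw [h3 7 (by decide), hs2.1 7 (by decide)]
  · intro a h7 h9 h14
    rw [h'' a h7, h3 a h9, hs2.1 a h14, h.1 a h7 h9 h14]
  · intro b u h10 h8
    have hs' : s' 1 = K.tableMemory := by rw [h.1 1 (by decide) (by decide) (by decide), hs]
    have hb : (var 10).eval s' = b := by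
      rw [eval_var, h.1 10 (by decide) (by decide) (by decide), h10]
    have hu : (var 8).eval s' = u := by
      rw [eval_var, h.1 8 (by decide) (by decide) (by decide), h8]
    have hv : (var 7).eval s' = i := by rw [eval_var, hc]
    have e1 := eval_cell (a := 3) (eval_pairIndex hs' hb hv)
    have e2 := eval_tableAt hs' (eval_pairIndex hs' hu hv) 2
    have e3 := hs2.2
    simp only [Expr.eval] at e1 e2 e3
    rw [e1, e2, eval_var, h.1 3 (by decide) (by decide) (by decide),
      h.1 12 (by decide) (by decide) (by decide)] at e3
    rw [h'' 9 (by decide), h3', Finset.sum_range_succ, ← h.2 b u h10 h8, ← e3]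
    simp only [Expr.eval, eval_var]
    rw [hs2.1 9 (by decide)]
    ring

theorem runs_takeOut (hs : s 1 = K.tableMemory) {h : ℕ} (hh : h < 4) :
    Runs (takeOut h) s (110 * (K.numWeights + 1)) fun s' =>
      (∀ a, a ≠ 3 → a ≠ 4 → a ≠ 6 → a ≠ 7 → a ≠ 13 → s' a = s a) ∧
      ∀ (v : Fin n) (q : ℕ), s 8 0 = (v : ℕ) → s 6 0 = q →
        s' 6 0 = (q + 1 : ℕ) ∧
        (∀ p, s' 4 p = if p = q then (K.bucket v h : ℝ) else s 4 p) ∧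
        ∀ b j, j < K.numWeights → s' 3 (b * K.numWeights + j) =
          s 3 (b * K.numWeights + j) -
            if K.bucket v h = b then K.weight v j * s 12 0 else 0 := by
  have hlim : K.entry (5 * 1) = K.numWeights := by simp [Sketch.entry]
  -- After `i` rounds exactly the mixtures with index `j < i` of this bucket are updated. Variable
  -- `13` is tracked because each round reads the bucket from it.
  let I : ℕ → Memory → Prop := fun i s' =>
      (∀ a, a ≠ 3 → a ≠ 4 → a ≠ 6 → a ≠ 7 → a ≠ 13 → s' a = s a) ∧
      ∀ (v : Fin n) (q : ℕ), s 8 0 = (v : ℕ) → s 6 0 = q →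
        s' 13 0 = (K.bucket v h : ℝ) ∧ s' 6 0 = (q + 1 : ℕ) ∧
        (∀ p, s' 4 p = if p = q then (K.bucket v h : ℝ) else s 4 p) ∧
        ∀ b j, j < K.numWeights → s' 3 (b * K.numWeights + j) =
          s 3 (b * K.numWeights + j) -
            if K.bucket v h = b ∧ j < i then K.weight v j * s 12 0 else 0
  have hloop : ∀ s1, I 0 s1 → Runs (forLoop 7 1 (.assign 3 (pairIndex (var 13) (var 7))
    (.minus (.cell 3 (pairIndex (var 13) (var 7)))
      (.times (tableAt 2 (pairIndex (var 8) (var 7))) (var 12))))) s1 ((47 + 13) *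
        (K.numWeights + 1)) (I K.numWeights) := by
    intro s1 hI
    refine Runs.forLoop I (fun s' h' => ⟨?_, ?_⟩) (fun i s' h' => ?_)
      fun i hi s' hI' hc => Runs.assign (by decide) ⟨?_, fun s'' h'' => ⟨?_, ?_⟩⟩
    · intro a h3 h4 h6 h7 h13
      rw [h' a h7, hI.1 a h3 h4 h6 h7 h13]
    · intro v q h8 h6
      rw [h' 13 (by decide), h' 6 (by decide), h' 4 (by decide), h' 3 (by decide)]
      exact hI.2 v q h8 h6
    · rw [h'.1 1 (by decide) (by decide) (by decide) (by decide) (by decide), hs,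
        Sketch.tableMemory, hlim]
    · rw [Memory.write_of_ne _ (by decide)]
    · intro a h3 h4 h6 h7 h13
      rw [h'' a h7, Memory.write_of_ne _ h3, hI'.1 a h3 h4 h6 h7 h13]
    · intro v q h8 h6
      obtain ⟨i1, i2, i3, i4⟩ := hI'.2 v q h8 h6
      have hfr : ∀ a, a ≠ 3 → a ≠ 7 → s'' a = s' a := fun a h3 h7 => by
        rw [h'' a h7, Memory.write_of_ne _ h3]
      rw [hfr 13 (by decide) (by decide), hfr 6 (by decide) (by decide),
        hfr 4 (by decide) (by decide)]
      refine ⟨i1, i2, i3, fun b j hj => ?_⟩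
      have hs' : s' 1 = K.tableMemory := by
        rw [hI'.1 1 (by decide) (by decide) (by decide) (by decide) (by decide), hs]
      have hb : (var 13).eval s' = (K.bucket v h : ℕ) := by rw [eval_var, i1]
      have hu : (var 8).eval s' = (v : ℕ) := by
        rw [eval_var, hI'.1 8 (by decide) (by decide) (by decide) (by decide) (by decide), h8]
      have hv : (var 7).eval s' = i := by rw [eval_var, hc]
      have e0 := eval_pairIndex hs' hb hv
      have e1 := eval_cell (a := 3) e0
      have e2 := eval_tableAt hs' (eval_pairIndex hs' hu hv) 2
      rw [K.entry_weight v hi] at e2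
      rw [h'' 3 (by decide), e0, Memory.write_natCast]
      split_ifs with hx hy hy
      · obtain ⟨rfl, rfl⟩ := pairIndex_inj hj hi hx
        simp only [Expr.eval] at e1 e2 ⊢
        rw [e1, e2, i4 _ _ hi, if_neg (by omega), eval_var,
          hI'.1 12 (by decide) (by decide) (by decide) (by decide) (by decide)]
        ring
      · obtain ⟨rfl, rfl⟩ := pairIndex_inj hj hi hx
        exact absurd ⟨rfl, Nat.lt_succ_self _⟩ hy
      · have : j ≠ i := by
          rintro rfl
          exact hx (by rw [hy.1])
        rw [i4 b j hj, if_pos ⟨hy.1, by omega⟩]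
      · rw [i4 b j hj, if_neg fun hz => hy ⟨hz.1, by omega⟩]
  refine (Runs.seq (T := 20) (Runs.setVar (by simp [tableAt, Expr.cost, var])
      fun s1 h1 h1' => And.intro h1 h1') fun s1 hs1 =>
    Runs.seq (T := 10) (P := fun s2 => (∀ a, a ≠ 4 → s2 a = s1 a) ∧
        ∀ q : ℕ, s1 6 0 = q → ∀ p, s2 4 p = if p = q then s1 13 0 else s1 4 p)
      (Runs.assign (by decide) ⟨fun a ha => Memory.write_of_ne _ ha _ _, fun q hq p => ?_⟩)
      fun s2 hs2 =>
    Runs.seq (T := 10) (Runs.setVar (by decide) fun s3 h3 h3' => And.intro h3 h3')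
      fun s3 hs3 => hloop s3 ⟨?_, ?_⟩).mono (by omega) ?_
  · rw [eval_var, eval_var, hq, Memory.write_natCast]
  · intro a h3 h4 h6 h7 h13
    rw [hs3.1 a h6, hs2.1 a h4, hs1.1 a h13]
  · intro v q h8 h6
    have hq : s1 6 0 = q := by rw [hs1.1 6 (by decide), h6]
    have hq2 : s2 6 0 = q := by rw [hs2.1 6 (by decide), hq]
    have hb : s1 13 0 = K.bucket v h := by
      have e : (Expr.plus (.times (.lit 4) (var 8)) (.lit h)).eval s = (4 * (v : ℕ) + h : ℕ) := by
        simp only [Expr.eval, eval_var, h8]; push_cast; ring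
      rw [hs1.2, eval_tableAt hs e, K.entry_bucket v hh]
    refine ⟨?_, ?_, ?_, ?_⟩
    · rw [hs3.1 13 (by decide), hs2.1 13 (by decide), hb]
    · rw [hs3.2, eval_var_add_one hq2]
    · intro p
      rw [hs3.1 4 (by decide), hs2.2 q hq p, hb, hs1.1 4 (by decide)]
    · intro b j hj
      rw [hs3.1 3 (by decide), hs2.1 3 (by decide), hs1.1 3 (by decide)]
      simp
  · rintro s' ⟨h1, h2⟩
    refine ⟨h1, fun v q h8 h6 => ?_⟩
    obtain ⟨-, i2, i3, i4⟩ := h2 v q h8 h6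
    refine ⟨i2, i3, fun b j hj => ?_⟩
    rw [i4 b j hj]
    simp [hj]

end Correctness

/-! ### One inspection by the program performs one step of peeling. -/

section Correctness

variable {n : ℕ} {K : Sketch n} {s : Memory}

theorem runs_accept (hs : s 1 = K.tableMemory) :
    Runs accept s (450 * (K.numWeights + 1)) fun s' =>
      (∀ a, a ≠ 2 → a ≠ 3 → a ≠ 4 → a ≠ 6 → a ≠ 7 → a ≠ 13 → s' a = s a) ∧
      ∀ (v : Fin n) (q : ℕ), s 8 0 = (v : ℕ) → s 6 0 = q →
        (∀ i : ℕ, s' 2 i = if i = v then s 12 0 else s 2 i) ∧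
        s' 6 0 = (q + 4 : ℕ) ∧
        (∀ p, s' 4 p = if q ≤ p ∧ p < q + 4 then (K.bucket v (p - q) : ℝ) else s 4 p) ∧
        ∀ b j, j < K.numWeights → s' 3 (b * K.numWeights + j) =
          s 3 (b * K.numWeights + j) -
            ∑ h ∈ Finset.range 4, if K.bucket v h = b then K.weight v j * s 12 0 else 0 := by
  refine (Runs.seq (T := 5) (P := fun s1 => (∀ a, a ≠ 2 → s1 a = s a) ∧
        ∀ v : ℕ, s 8 0 = v → ∀ i, s1 2 i = if i = v then s 12 0 else s 2 i)
      (Runs.assign (by decide) ⟨fun a ha => Memory.write_of_ne _ ha _ _, fun v hv i => ?_⟩)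
      fun s1 hs1 => ?_).mono (T := 5 + (110 * (K.numWeights + 1) + (110 * (K.numWeights + 1) +
        (110 * (K.numWeights + 1) + 110 * (K.numWeights + 1))))) (by omega) fun _ h => h
  · rw [eval_var, eval_var, hv, Memory.write_natCast]
  have t1 : s1 1 = K.tableMemory := by rw [hs1.1 1 (by decide), hs]
  refine Runs.seq (runs_takeOut t1 (by decide)) fun s2 hs2 => ?_
  have t2 : s2 1 = K.tableMemory := by
    rw [hs2.1 1 (by decide) (by decide) (by decide) (by decide) (by decide), t1]
  refine Runs.seq (runs_takeOut t2 (by decide)) fun s3 hs3 => ?_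
  have t3 : s3 1 = K.tableMemory := by
    rw [hs3.1 1 (by decide) (by decide) (by decide) (by decide) (by decide), t2]
  refine Runs.seq (runs_takeOut t3 (by decide)) fun s4 hs4 => ?_
  have t4 : s4 1 = K.tableMemory := by
    rw [hs4.1 1 (by decide) (by decide) (by decide) (by decide) (by decide), t3]
  refine (runs_takeOut t4 (by decide)).mono le_rfl fun s5 hs5 => ⟨?_, ?_⟩
  · intro a h2 h3 h4 h6 h7 h13
    rw [hs5.1 a h3 h4 h6 h7 h13, hs4.1 a h3 h4 h6 h7 h13, hs3.1 a h3 h4 h6 h7 h13,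
      hs2.1 a h3 h4 h6 h7 h13, hs1.1 a h2]
  · intro v q h8 h6
    have u2 := fun a h3 h4 h6 h7 h13 => hs2.1 a h3 h4 h6 h7 h13
    have u3 := fun a h3 h4 h6 h7 h13 => (hs3.1 a h3 h4 h6 h7 h13).trans (u2 a h3 h4 h6 h7 h13)
    have u4 := fun a h3 h4 h6 h7 h13 => (hs4.1 a h3 h4 h6 h7 h13).trans (u3 a h3 h4 h6 h7 h13)
    have u5 := fun a h3 h4 h6 h7 h13 => (hs5.1 a h3 h4 h6 h7 h13).trans (u4 a h3 h4 h6 h7 h13)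
    have v1 : s1 8 0 = (v : ℕ) := by rw [hs1.1 8 (by decide), h8]
    have q1 : s1 6 0 = q := by rw [hs1.1 6 (by decide), h6]
    have y1 : s1 12 0 = s 12 0 := by rw [hs1.1 12 (by decide)]
    obtain ⟨a2, b2, c2⟩ := hs2.2 v q v1 q1
    obtain ⟨a3, b3, c3⟩ := hs3.2 v (q + 1)
      (by rw [u2 8 (by decide) (by decide) (by decide) (by decide) (by decide), v1]) a2
    obtain ⟨a4, b4, c4⟩ := hs4.2 v (q + 1 + 1)
      (by rw [u3 8 (by decide) (by decide) (by decide) (by decide) (by decide), v1]) a3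
    obtain ⟨a5, b5, c5⟩ := hs5.2 v (q + 1 + 1 + 1)
      (by rw [u4 8 (by decide) (by decide) (by decide) (by decide) (by decide), v1]) a4
    rw [y1] at c2
    rw [u2 12 (by decide) (by decide) (by decide) (by decide) (by decide), y1] at c3
    rw [u3 12 (by decide) (by decide) (by decide) (by decide) (by decide), y1] at c4
    rw [u4 12 (by decide) (by decide) (by decide) (by decide) (by decide), y1] at c5
    refine ⟨?_, a5, ?_, ?_⟩
    · intro i
      rw [u5 2 (by decide) (by decide) (by decide) (by decide) (by decide), hs1.2 v h8]
    · intro p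
      rw [b5, b4, b3, b2, hs1.1 4 (by decide)]
      by_cases hp : q ≤ p ∧ p < q + 4
      · rw [if_pos hp]
        obtain ⟨r, rfl⟩ := Nat.exists_eq_add_of_le hp.1
        have hr : r < 4 := by omega
        rw [Nat.add_sub_cancel_left]
        interval_cases r <;> simp [add_assoc]
      · rw [if_neg hp, if_neg (by omega), if_neg (by omega), if_neg (by omega), if_neg (by omega)]
    · intro b j hj
      rw [c5 b j hj, c4 b j hj, c3 b j hj, c2 b j hj, hs1.1 3 (by decide)]
      simp only [Finset.sum_range_succ, Finset.sum_range_zero]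
      ring

/-- The requirements on a sketch under which the reconstruction program works. -/
structure Sketch.Valid (K : Sketch n) : Prop where
  numBuckets_pos : 0 < K.numBuckets
  bucket_lt : ∀ v h, h < 4 → K.bucket v h < K.numBuckets
  bucket_disjoint : ∀ v w h h', h < 4 → h' < 4 → K.bucket v h = K.bucket w h' → h = h'
  numDigits_lt : K.numDigits < K.numWeights
  weight_zero : ∀ v, K.weight v 0 = 1
  weight_succ : ∀ (v : Fin n) (j : ℕ), j < K.numDigits →
    K.weight v (j + 1) = v / K.base ^ (K.numDigits - 1 - j) % K.base
  le_pow : n ≤ K.base ^ K.numDigits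

/-- The memory represents the state `S` of the peeling process for the delays `d`. -/
structure Represents (K : Sketch n) (d : Fin n → ℝ) (S : PeelState n) (s : Memory) : Prop where
  output : ∀ v : Fin n, s 2 v = if v ∈ S.rest then 0 else d v
  mixture : ∀ b < K.numBuckets, ∀ j < K.numWeights, s 3 (b * K.numWeights + j) =
    ∑ v ∈ S.members K.bucket b, K.weight v j * d v
  queue : ∀ p, s 4 p = S.queue p
  tail : s 6 0 = S.tail

theorem Represents.congr {d : Fin n → ℝ} {S : PeelState n} {s' : Memory}
    (h : Represents K d S s) (h2 : s' 2 = s 2) (h3 : s' 3 = s 3) (h4 : s' 4 = s 4)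
    (h6 : s' 6 = s 6) : Represents K d S s' :=
  ⟨by rw [h2]; exact h.output, by rw [h3]; exact h.mixture, by rw [h4]; exact h.queue,
    by rw [h6]; exact h.tail⟩

/-- No node is mistaken for the mixture of the nodes in `A`. -/
def Sketch.Unambiguous (K : Sketch n) (d : Fin n → ℝ) (A : Finset (Fin n)) : Prop :=
  2 ≤ A.card → ¬ ∃ u : Fin n, ∀ j < K.numWeights,
    ∑ v ∈ A, K.weight v j * d v = K.weight u j * ∑ v ∈ A, d v

/-- The four buckets of a node are distinct, so the four subtractions in `accept` remove it exactly
once from each bucket that it touches. -/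
theorem sum_ite_bucket_eq (hK : K.Valid) (v : Fin n) (b : ℕ) (y : ℝ) [Decidable (Touches K.bucket v b)] :
    (∑ h ∈ Finset.range 4, if K.bucket v h = b then y else 0) =
      if Touches K.bucket v b then y else 0 := by
  split_ifs with ht
  · obtain ⟨h, h4, rfl⟩ := ht
    rw [Finset.sum_eq_single_of_mem h (Finset.mem_range.2 h4), if_pos rfl]
    intro h' h4' hne
    exact if_neg fun e => hne (hK.bucket_disjoint _ _ _ _ (Finset.mem_range.1 h4') h4 e)
  · apply Finset.sum_eq_zero
    intro h h4
    exact if_neg fun e => ht ⟨h, Finset.mem_range.1 h4, e⟩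

theorem Represents.remove (hK : K.Valid) {d : Fin n → ℝ} {S : PeelState n} {s' : Memory}
    (hS : Represents K d S s) {v : Fin n} (hv : v ∈ S.rest)
    (h2 : ∀ i : ℕ, s' 2 i = if i = v then d v else s 2 i)
    (h6 : s' 6 0 = (S.tail + 4 : ℕ))
    (h4 : ∀ p, s' 4 p = if S.tail ≤ p ∧ p < S.tail + 4 then (K.bucket v (p - S.tail) : ℝ)
      else s 4 p)
    (h3 : ∀ b j, j < K.numWeights → s' 3 (b * K.numWeights + j) =
          s 3 (b * K.numWeights + j) -
            ∑ h ∈ Finset.range 4, if K.bucket v h = b then K.weight v j * d v else 0) :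
    Represents K d (S.remove K.bucket v) s' := by
  classical
  refine ⟨fun w => ?_, fun b hb j hj => ?_, fun p => ?_, h6⟩
  · rw [h2, hS.output w]
    simp only [PeelState.remove, Finset.mem_erase, Fin.val_inj]
    by_cases hw : w = v
    · simp [hw]
    · simp [hw]
  · rw [h3 b j hj, hS.mixture b hb j hj, sum_ite_bucket_eq hK]
    split_ifs with ht
    · have : (S.remove K.bucket v).members K.bucket b = (S.members K.bucket b).erase v := by
        ext x
        simp only [PeelState.mem_members, PeelState.remove, Finset.mem_erase, and_assoc]
      rw [this, Finset.sum_erase_eq_sub (PeelState.mem_members.2 ⟨hv, ht⟩)]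
    · have : (S.remove K.bucket v).members K.bucket b = S.members K.bucket b := by
        ext x
        simp only [PeelState.mem_members, PeelState.remove, Finset.mem_erase]
        constructor
        · rintro ⟨⟨-, h1⟩, h2⟩; exact ⟨h1, h2⟩
        · rintro ⟨hx, hx'⟩
          refine ⟨⟨?_, hx⟩, hx'⟩
          rintro rfl
          exact ht hx'
      rw [this, sub_zero]
  · rw [h4 p, hS.queue p]
    simp only [PeelState.remove]
    split_ifs <;> rfl

/-- Halting and the time bound are unconditional; the simulation of `peelStep` is an implication in
the postcondition. Thus a run that has gone astray still ends in time. -/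
theorem runs_inspect (hK : K.Valid) (hs : s 1 = K.tableMemory) {i : ℕ} (hi : s 5 0 = i)
    {d : Fin n → ℝ} (S : PeelState n) :
    Runs inspect s (700 * (K.numWeights + 1)) fun s' => s' 1 = s 1 ∧ s' 5 = s 5 ∧
      ((∀ p, S.current K.numBuckets p < K.numBuckets) → (∀ v ∈ S.rest, d v ≠ 0) →
        K.Unambiguous d (S.members K.bucket (S.current K.numBuckets i)) →
        Represents K d S s → Represents K d (peelStep K.numBuckets K.bucket i S) s') := by
  have hheader : K.entry (5 * 0) = K.numBuckets := by simp [Sketch.entry]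
  refine Runs.mono (T := (7 + 5) + (10 + (60 * (K.numDigits + 1) + (4 +
    (70 * (K.numWeights + 1) + (7 + (5 + (4 + 450 * (K.numWeights + 1)))))))))
    (Runs.seq (P := fun s1 => (∀ a, a ≠ 10 → s1 a = s a) ∧
      ((∀ p, s 4 p = S.queue p) → s1 10 0 = S.current K.numBuckets i))
    (Runs.ite (by decide)
      (fun hle => Runs.setVar (by decide) fun s' h h' => ⟨h, fun hq => ?_⟩)
      fun hle => Runs.setVar (by decide) fun s' h h' => ⟨h, fun hq => ?_⟩) fun s1 hs1 => ?_)
    (by have := hK.numDigits_lt; omega) fun _ h => h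
  · rw [eval_header_table hs, eval_var_add_one hi, hheader, Nat.cast_le] at hle
    rw [h', eval_var, hi, PeelState.current, if_pos (by omega)]
  · rw [eval_header_table hs, eval_var_add_one hi, hheader, Nat.cast_le] at hle
    have hv : (var 5).eval s = i := by rw [eval_var, hi]
    rw [h', eval_cell hv, hq, PeelState.current, if_neg (by omega)]
  have t1 : s1 1 = K.tableMemory := by rw [hs1.1 1 (by decide), hs]
  refine Runs.seq (P := fun s2 => (∀ a, a ≠ 12 → s2 a = s1 a) ∧ ∀ b : ℕ, s1 10 0 = b →
      s2 12 0 = s1 3 (b * K.numWeights + 0))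
    (Runs.setVar (by decide) fun s' h h' => ⟨h, fun b hb => ?_⟩) fun s2 hs2 => ?_
  · rw [h', eval_cell (eval_pairIndex t1 (by rw [eval_var, hb]) rfl)]
  have t2 : s2 1 = K.tableMemory := by rw [hs2.1 1 (by decide), t1]
  refine Runs.seq (runs_identify t2) fun s3 hs3 => ?_
  refine Runs.seq (P := fun s4 => (∀ a, a ≠ 11 → s4 a = s3 a) ∧ ∀ u : ℕ, s3 8 0 = u →
      s4 11 u = 1)
    (Runs.assign (by decide) ⟨fun a ha => Memory.write_of_ne _ ha _ _, fun u hu => ?_⟩)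
    fun s4 hs4 => ?_
  · rw [eval_var, hu, Memory.write_natCast, if_pos rfl]
    simp [Expr.eval]
  have t4 : s4 1 = K.tableMemory := by
    rw [hs4.1 1 (by decide), hs3.1 1 (by decide) (by decide), t2]
  refine Runs.seq (runs_verify t4) fun s5 hs5 => ?_
  have fr4 : ∀ a, a ≠ 7 → a ≠ 8 → a ≠ 10 → a ≠ 11 → a ≠ 12 → s4 a = s a := by
    intro a h7 h8 h10 h11 h12
    rw [hs4.1 a h11, hs3.1 a h7 h8, hs2.1 a h12, hs1.1 a h10]
  have fr : ∀ a, a ≠ 7 → a ≠ 8 → a ≠ 9 → a ≠ 10 → a ≠ 11 → a ≠ 12 → a ≠ 14 → s5 a = s a := by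
    intro a h7 h8 h9 h10 h11 h12 h14
    rw [hs5.1 a h7 h9 h14, fr4 a h7 h8 h10 h11 h12]
  have t5 : s5 1 = K.tableMemory := by
    rw [fr 1 (by decide) (by decide) (by decide) (by decide) (by decide) (by decide) (by decide),
      hs]
  have i5 : s5 5 = s 5 :=
    fr 5 (by decide) (by decide) (by decide) (by decide) (by decide) (by decide) (by decide)
  have y5 : s5 12 0 = s2 12 0 := by
    rw [hs5.1 12 (by decide) (by decide) (by decide), hs4.1 12 (by decide),
      hs3.1 12 (by decide) (by decide)]
  have u5 : s5 8 0 = s3 8 0 := by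
    rw [hs5.1 8 (by decide) (by decide) (by decide), hs4.1 8 (by decide)]
  have r5 : Represents K d S s → Represents K d S s5 := fun hS => hS.congr
    (fr 2 (by decide) (by decide) (by decide) (by decide) (by decide) (by decide) (by decide))
    (fr 3 (by decide) (by decide) (by decide) (by decide) (by decide) (by decide) (by decide))
    (fr 4 (by decide) (by decide) (by decide) (by decide) (by decide) (by decide) (by decide))
    (fr 6 (by decide) (by decide) (by decide) (by decide) (by decide) (by decide) (by decide))
  -- the mixture in the bucket that is inspected
  have hy : (∀ p, S.current K.numBuckets p < K.numBuckets) → Represents K d S s →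
      s2 12 0 = ∑ v ∈ S.members K.bucket (S.current K.numBuckets i), d v := by
    intro hcur hS
    rw [hs2.2 _ (hs1.2 hS.queue), hs1.1 3 (by decide),
      hS.mixture _ (hcur i) 0 (by have := hK.numDigits_lt; omega)]
    exact Finset.sum_congr rfl fun v _ => by rw [hK.weight_zero, Nat.cast_one, one_mul]
  have hdev : (∀ p, S.current K.numBuckets p < K.numBuckets) → Represents K d S s →
      ∀ u : ℕ, s3 8 0 = u → s5 9 0 = ∑ j ∈ Finset.range K.numWeights,
        (∑ v ∈ S.members K.bucket (S.current K.numBuckets i), K.weight v j * d v -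
          K.entry (5 * (u * K.numWeights + j) + 2) *
            ∑ v ∈ S.members K.bucket (S.current K.numBuckets i), d v) ^ 2 := by
    intro hcur hS u hu
    rw [hs5.2 (S.current K.numBuckets i) u (by
      rw [hs4.1 10 (by decide), hs3.1 10 (by decide) (by decide), hs2.1 10 (by decide),
        hs1.2 hS.queue]) (by rw [hs4.1 8 (by decide), hu])]
    refine Finset.sum_congr rfl fun j hj => ?_
    rw [fr4 3 (by decide) (by decide) (by decide) (by decide) (by decide),
      hS.mixture _ (hcur i) j (Finset.mem_range.1 hj), hs4.1 12 (by decide),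
      hs3.1 12 (by decide) (by decide), hy hcur hS]
  have hsingle : (∀ p, S.current K.numBuckets p < K.numBuckets) → (∀ v ∈ S.rest, d v ≠ 0) →
      Represents K d S s → ∀ v, S.members K.bucket (S.current K.numBuckets i) = {v} →
      d v ≠ 0 ∧ s2 12 0 = d v ∧ s3 8 0 = (v : ℕ) := by
    intro hcur hd hS v hv
    have hvR : v ∈ S.rest := (PeelState.mem_members.1 (hv ▸ Finset.mem_singleton_self v)).1
    have hyv : s2 12 0 = d v := by rw [hy hcur hS, hv, Finset.sum_singleton]
    refine ⟨hd v hvR, hyv, hs3.2 (S.current K.numBuckets i) v ?_ ?_ ?_ ?_⟩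
    · rw [hs2.1 10 (by decide), hs1.2 hS.queue]
    · rw [hyv]; exact hd v hvR
    · intro j hj
      rw [hs2.1 3 (by decide), hs1.1 3 (by decide), hS.mixture _ (hcur i) (j + 1)
        (by have := hK.numDigits_lt; omega), hv, Finset.sum_singleton, hyv, hK.weight_succ v j hj]
    · exact v.isLt.trans_le hK.le_pow
  have hstay : (∀ v, S.members K.bucket (S.current K.numBuckets i) ≠ {v}) → Represents K d S s →
      Represents K d (peelStep K.numBuckets K.bucket i S) s5 := by
    intro hne hS
    rw [peelStep_of_card_ne_one _ _ fun h => by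
      obtain ⟨v, hv⟩ := Finset.card_eq_one.1 h
      exact hne v hv]
    exact r5 hS
  -- Four outcomes: the total is zero, acceptance, a nonzero deviation, or a guess that is not a
  -- natural number. In each rejecting case the bucket cannot have had exactly one node.
  refine Runs.ite (by decide) (fun hle => Runs.skip ⟨t5.trans hs.symm, i5, ?_⟩) fun hlt =>
    Runs.ite (by decide) (fun hle => Runs.ite (by decide) (fun hle' => ?_) fun hlt' =>
      Runs.skip ⟨t5.trans hs.symm, i5, ?_⟩) fun hlt' => Runs.skip ⟨t5.trans hs.symm, i5, ?_⟩
  · intro hcur hd _ hS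
    refine hstay (fun v hv => ?_) hS
    obtain ⟨h1, h2, -⟩ := hsingle hcur hd hS v hv
    simp only [Expr.eval, eval_var, y5, h2, Nat.cast_zero] at hle
    exact h1 (mul_self_eq_zero.1 (le_antisymm hle (mul_self_nonneg _)))
  · refine (runs_accept t5).mono le_rfl fun s6 hs6 => ⟨?_, ?_, ?_⟩
    · rw [hs6.1 1 (by decide) (by decide) (by decide) (by decide) (by decide) (by decide), t5, hs]
    · rw [hs6.1 5 (by decide) (by decide) (by decide) (by decide) (by decide) (by decide), i5]
    intro hcur hd hamb hS
    -- Reading at an index that is not a natural number returns `0`, so the test `1 ≤ a[x]` passes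
    -- only for a natural number.
    obtain ⟨u, hu⟩ : ∃ u : ℕ, (u : ℝ) = s5 8 0 := by
      by_contra hno
      simp only [Expr.eval, eval_var] at hle
      rw [Memory.read, if_neg hno] at hle
      norm_num at hle
    have hu3 : s3 8 0 = u := by rw [← u5, hu]
    have hy0 : ∑ v ∈ S.members K.bucket (S.current K.numBuckets i), d v ≠ 0 := by
      intro h0
      apply hlt
      simp only [Expr.eval, eval_var, y5, hy hcur hS, h0]
      simp
    have hall : ∀ j < K.numWeights,
        ∑ v ∈ S.members K.bucket (S.current K.numBuckets i), K.weight v j * d v =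
          K.entry (5 * (u * K.numWeights + j) + 2) *
            ∑ v ∈ S.members K.bucket (S.current K.numBuckets i), d v := by
      have h0 : s5 9 0 ≤ 0 := by simpa [Expr.eval, eval_var] using hle'
      rw [hdev hcur hS u hu3] at h0
      have h1 := (Finset.sum_eq_zero_iff_of_nonneg fun j _ => sq_nonneg _).1
        (le_antisymm h0 (Finset.sum_nonneg fun j _ => sq_nonneg _))
      intro j hj
      exact sub_eq_zero.1 (pow_eq_zero_iff two_ne_zero |>.1 (h1 j (Finset.mem_range.2 hj)))
    have hun : u < n := by
      by_contra hge
      have h1 := hall 0 (by have := hK.numDigits_lt; omega)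
      rw [K.entry_weight_of_le (not_lt.1 hge), Nat.cast_zero, zero_mul,
        Finset.sum_congr rfl fun v _ => by rw [hK.weight_zero, Nat.cast_one, one_mul]] at h1
      exact hy0 h1
    -- An empty bucket is excluded by the nonzero total, and two or more nodes by `hamb`.
    obtain ⟨w, hw⟩ : ∃ w, S.members K.bucket (S.current K.numBuckets i) = {w} := by
      rw [← Finset.card_eq_one]
      by_contra hne
      have hpos : (S.members K.bucket (S.current K.numBuckets i)).card ≠ 0 := by
        intro h0
        rw [Finset.card_eq_zero] at h0
        rw [h0] at hy0
        exact hy0 Finset.sum_empty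
      refine hamb (by omega) ⟨⟨u, hun⟩, fun j hj => ?_⟩
      rw [hall j hj, ← K.entry_weight ⟨u, hun⟩ hj]
    obtain ⟨h1, h2, h3⟩ := hsingle hcur hd hS w hw
    have hS5 := r5 hS
    obtain ⟨a2, a6, a4, a3⟩ := hs6.2 w S.tail (by rw [u5, h3]) hS5.tail
    rw [y5, h2] at a2 a3
    rw [peelStep_of_eq_singleton _ _ hw]
    exact hS5.remove hK (PeelState.mem_members.1 (hw ▸ Finset.mem_singleton_self w)).1 a2 a6 a4 a3
  · intro hcur hd _ hS
    refine hstay (fun v hv => ?_) hS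
    obtain ⟨h1, h2, h3⟩ := hsingle hcur hd hS v hv
    apply hlt'
    have h4 := hdev hcur hS v h3
    rw [Finset.sum_eq_zero fun j hj => by
      rw [hv, Finset.sum_singleton, Finset.sum_singleton,
        K.entry_weight v (Finset.mem_range.1 hj), sub_self, zero_pow two_ne_zero]] at h4
    simp [Expr.eval, eval_var, h4]
  · intro hcur hd _ hS
    refine hstay (fun v hv => ?_) hS
    obtain ⟨h1, h2, h3⟩ := hsingle hcur hd hS v hv
    apply hlt'
    have h4 : (var 8).eval s5 = (v : ℕ) := by rw [eval_var, u5, h3]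
    rw [eval_cell h4, hs5.1 11 (by decide) (by decide) (by decide), hs4.2 v h3]
    simp [Expr.eval]

open Classical in
/-- The reconstruction program halts in time on every memory that holds the table of a valid
sketch, and it finds the delays unless there is a core or an ambiguous mixture. -/
theorem runs_reconstruct (hK : K.Valid) (hs : s 1 = K.tableMemory) (d : Fin n → ℝ) :
    Runs reconstruct s (60 * (K.numBuckets * K.numWeights + 1) +
        720 * ((K.numWeights + 1) * (K.numSteps + 1))) fun s' =>
      s 2 = 0 → s 4 = 0 →
      (∀ b < K.numBuckets, ∀ j < K.numWeights,
        s 0 (2 * (b * K.numWeights + j) + 1) - s 0 (2 * (b * K.numWeights + j) + 2) +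
          ((K.gain (b * K.numWeights + j) : ℝ) - K.loss (b * K.numWeights + j)) * s 0 0 =
        ∑ v, if Touches K.bucket v b then K.weight v j * d v else 0) →
      K.numBuckets + 4 * (Finset.univ.filter fun v => d v ≠ 0).card ≤ K.numSteps →
      (¬ ∃ S ⊆ Finset.univ.filter fun v => d v ≠ 0, S.Nonempty ∧
        ∀ h < 4, IsCore (fun v => K.bucket v h) S) →
      (∀ i < K.numSteps, K.Unambiguous d
        ((peel K.numBuckets K.bucket (Finset.univ.filter fun v => d v ≠ 0) i).members K.bucket
          ((peel K.numBuckets K.bucket (Finset.univ.filter fun v => d v ≠ 0) i).current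
            K.numBuckets i))) →
      ∀ v : Fin n, s' 2 v = d v := by
  set supp := Finset.univ.filter fun v => d v ≠ 0 with hsupp
  have hlim : K.entry (5 * 4) = K.numSteps := by simp [Sketch.entry]
  have hheader : K.entry (5 * 0) = K.numBuckets := by simp [Sketch.entry]
  -- The assumptions for correctness are carried inside the loop invariant, so that the time bound
  -- holds without them.
  let P : Prop := (s 2 = 0) ∧ (s 4 = 0) ∧
      (∀ b < K.numBuckets, ∀ j < K.numWeights,
        s 0 (2 * (b * K.numWeights + j) + 1) - s 0 (2 * (b * K.numWeights + j) + 2) +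
          ((K.gain (b * K.numWeights + j) : ℝ) - K.loss (b * K.numWeights + j)) * s 0 0 =
        ∑ v, if Touches K.bucket v b then K.weight v j * d v else 0) ∧
      (∀ i < K.numSteps, K.Unambiguous d
        ((peel K.numBuckets K.bucket supp i).members K.bucket
          ((peel K.numBuckets K.bucket supp i).current K.numBuckets i)))
  refine (Runs.seq (runs_prepare hs) fun s1 hs1 => Runs.seq (T := 5)
    (Runs.setVar (by decide) fun s2 h2 h2' => And.intro h2 h2') fun s2 hs2 =>
    Runs.forLoop (B := 700 * (K.numWeights + 1)) (K := K.numSteps)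
      (fun i s' => s' 1 = K.tableMemory ∧
        (P → Represents K d (peel K.numBuckets K.bucket supp i) s')) (fun s' h => ⟨?_, ?_⟩)
      (fun i s' h => ?_) fun i hi s' h hc => ?_).mono ?_ ?_
  · rw [h 1 (by decide), hs2.1 1 (by decide), hs1.1 1 (by decide) (by decide), hs]
  · rintro ⟨p2, p4, p0, -⟩
    refine ⟨fun v => ?_, fun b hb j hj => ?_, fun p => ?_, ?_⟩
    · rw [h 2 (by decide), hs2.1 2 (by decide), hs1.1 2 (by decide) (by decide), p2]
      by_cases hv : d v = 0 <;> simp [peel, hsupp, hv]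
    · have hx : b * K.numWeights + j < K.numBuckets * K.numWeights := by
        have := Nat.mul_le_mul_right K.numWeights (Nat.succ_le_of_lt hb)
        rw [Nat.succ_mul] at this
        omega
      rw [h 3 (by decide), hs2.1 3 (by decide), hs1.2 _ hx, p0 b hb j hj, PeelState.members,
        Finset.sum_filter]
      simp only [peel, hsupp]
      rw [Finset.sum_filter]
      refine Finset.sum_congr rfl fun v _ => ?_
      by_cases hv : d v = 0 <;> simp [hv]
    · rw [h 4 (by decide), hs2.1 4 (by decide), hs1.1 4 (by decide) (by decide), p4]
      simp [peel]
    · have t1 : s1 1 = K.tableMemory := by rw [hs1.1 1 (by decide) (by decide), hs]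
      rw [h 6 (by decide), hs2.2, eval_header_table t1, hheader]
      rfl
  · rw [h.1, Sketch.tableMemory, hlim]
  · refine (runs_inspect hK h.1 hc (d := d) (peel K.numBuckets K.bucket supp i)).mono le_rfl
      fun s3 hs3 => ⟨by rw [hs3.2.1], fun s4 hs4 => ⟨?_, fun hP => ?_⟩⟩
    · rw [hs4 1 (by decide), hs3.1, h.1]
    · have hI := peelInvariant_peel hK.numBuckets_pos hK.bucket_lt supp i
      refine (hs3.2.2 hI.current_lt (fun v hv => ?_) (hP.2.2.2 i hi) (h.2 hP)).congr
        (hs4 2 (by decide)) (hs4 3 (by decide)) (hs4 4 (by decide)) (hs4 6 (by decide))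
      have := hI.subset hv
      simpa [hsupp] using this
  · have h1 : K.numSteps + 1 ≤ (K.numWeights + 1) * (K.numSteps + 1) :=
      Nat.le_mul_of_pos_left _ (Nat.succ_pos _)
    rw [add_mul (700 * (K.numWeights + 1)), mul_assoc 700]
    omega
  · rintro s' ⟨-, h⟩ h2 h4 h0 hT hcore hamb v
    rw [(h ⟨h2, h4, h0, hamb⟩).output v, rest_peel_eq_empty hK.numBuckets_pos hK.bucket_lt
      hK.bucket_disjoint hcore hT]
    simp

end Correctness

/-! ### The designs -/

section Designs

variable {n : ℕ} {G : SimpleGraph (Fin n)} (K : Sketch n) {z : Fin n} (p : ∀ v, G.Walk v z)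

open Classical in
/-- The nodes which are hashed to the bucket `b`. -/
noncomputable def Sketch.nodesIn (b : ℕ) : Finset (Fin n) :=
  Finset.univ.filter fun v => Touches K.bucket v b

/-- The measurement paths: the root alone, and two tours for each bucket and each weight. -/
noncomputable def Sketch.route (i : ℕ) : Route G :=
  if i = 0 then ⟨z, z, .nil⟩
  else ⟨z, z, tour p (fun v => K.weight v ((i - 1) / 2 % K.numWeights)) (i % 2 = 1)
    (K.nodesIn ((i - 1) / 2 / K.numWeights)).toList⟩

/-- The measurement paths together with the table. -/
noncomputable def Sketch.design : Design G where
  routes := (List.range (2 * (K.numBuckets * K.numWeights) + 1)).map (K.route p)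
  table := K.table

theorem Sketch.initial_design_outputs (d : Fin n → ℝ) {i : ℕ}
    (hi : i < 2 * (K.numBuckets * K.numWeights) + 1) :
    (K.design p).initial d 0 i = (K.route p i).delay d := by
  simp only [Design.initial, Design.outputs, Sketch.design, List.map_map]
  rw [List.getD_eq_getElem?_getD, List.getElem?_map, List.getElem?_range hi]
  rfl

theorem Sketch.initial_design_table (d : Fin n → ℝ) :
    (K.design p).initial d 1 = K.tableMemory := by
  funext i
  simp only [Design.initial, Sketch.design, K.getD_table, Sketch.tableMemory]

/-- Outputs `2 x + 1` and `2 x + 2` are the two tours for the pair `x`. Their difference is the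
mixture minus a signed multiple of `d z`; output `0` is `d z` itself, and `gain - loss` is the
multiple to be restored. -/
theorem Sketch.initial_design_mixture (d : Fin n → ℝ) {b j : ℕ} (hb : b < K.numBuckets)
    (hj : j < K.numWeights)
    (hgain : (K.gain (b * K.numWeights + j) : ℝ) - K.loss (b * K.numWeights + j) =
      ∑ v ∈ K.nodesIn b, K.weight v j * (-1 : ℝ) ^ (p v).length) :
    (K.design p).initial d 0 (2 * (b * K.numWeights + j) + 1) -
        (K.design p).initial d 0 (2 * (b * K.numWeights + j) + 2) +
        ((K.gain (b * K.numWeights + j) : ℝ) - K.loss (b * K.numWeights + j)) *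
          (K.design p).initial d 0 0 =
      ∑ v ∈ K.nodesIn b, K.weight v j * d v := by
  have hx : b * K.numWeights + j < K.numBuckets * K.numWeights := by
    have := Nat.mul_le_mul_right K.numWeights (Nat.succ_le_of_lt hb)
    rw [Nat.succ_mul] at this
    omega
  have h3 : (b * K.numWeights + j) / K.numWeights = b := by
    rw [mul_comm, Nat.mul_add_div (by omega), Nat.div_eq_of_lt hj, add_zero]
  have h4 : (b * K.numWeights + j) % K.numWeights = j := by
    rw [mul_comm, Nat.mul_add_mod, Nat.mod_eq_of_lt hj]
  rw [K.initial_design_outputs p d (by omega), K.initial_design_outputs p d (by omega),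
    K.initial_design_outputs p d (by omega), hgain]
  generalize hX : b * K.numWeights + j = x at h3 h4
  have e1 : (2 * x + 1 - 1) / 2 = x := by omega
  have e2 : (2 * x + 2 - 1) / 2 = x := by omega
  have e3 : (2 * x + 1) % 2 = 1 := by omega
  have e4 : ¬ (2 * x + 2) % 2 = 1 := by omega
  have f0 : (K.route p 0).delay d = d z := by
    rw [Route.delay_eq]; simp [Sketch.route]
  have f1 : (K.route p (2 * x + 1)).delay d = d z + tailDelay d
      (tour p (fun v => K.weight v j) true (K.nodesIn b).toList) := by
    rw [Route.delay_eq, Sketch.route, if_neg (by omega)]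
    simp only [e1, e3, h3, h4, decide_true]
  have f2 : (K.route p (2 * x + 2)).delay d = d z + tailDelay d
      (tour p (fun v => K.weight v j) false (K.nodesIn b).toList) := by
    rw [Route.delay_eq, Sketch.route, if_neg (by omega)]
    simp only [e2, e4, h3, h4, decide_false]
  have f3 := tailDelay_tour p (fun v => K.weight v j) d (K.nodesIn b).toList
  rw [Finset.sum_map_toList] at f3
  rw [f0, f1, f2, add_sub_add_left_eq_sub, f3, Finset.sum_mul, ← Finset.sum_add_distrib]
  exact Finset.sum_congr rfl fun v _ => by ring

theorem Sketch.numLinks_route_le {D t : ℕ} (hp : ∀ v, (p v).length ≤ D)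
    (ht : ∀ b, (K.nodesIn b).card ≤ t) (i : ℕ) : (K.route p i).numLinks ≤ D * t := by
  unfold Sketch.route
  split_ifs with h
  · simp [Route.numLinks]
  · refine (card_edges_tour p _ _ hp _).trans (Nat.mul_le_mul_left _ ?_)
    rw [Finset.length_toList]
    exact ht _

theorem Sketch.numHops_route_le {D t M : ℕ} (hp : ∀ v, (p v).length ≤ D)
    (ht : ∀ b, (K.nodesIn b).card ≤ t) (hM : ∀ v j, K.weight v j ≤ M) (i : ℕ) :
    (K.route p i).numHops ≤ (2 * M + 4) * D * t := by
  unfold Sketch.route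
  split_ifs with h
  · simp [Route.numHops]
  · refine (length_tour p _ _ hp (fun v => hM v _) _).trans (Nat.mul_le_mul_left _ ?_)
    rw [Finset.length_toList]
    exact ht _

end Designs

/-! ### The random sketch: hash functions, digits and signs. -/

section RandomSketch

variable {n : ℕ}

/-- The four buckets of a node, from four hash functions with values in `Fin m`. -/
def hashBucket {m : ℕ} (t : ℕ) (f : Fin 4 → Fin n → Fin m) (v : Fin n) (h : ℕ) : ℕ :=
  if hh : h < 4 then h * (2 * m) + refine t (f ⟨h, hh⟩) v else 0

/-- The weights of a node: `1`, the `L` digits of the node in base `M`, and `3 L` digits given by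
`w`. -/
def digitWeight {L M : ℕ} (w : Fin n → Fin (3 * L) → Fin M) (v : Fin n) (j : ℕ) : ℕ :=
  if j = 0 then 1
  else if j ≤ L then v / M ^ (L - j) % M
  else if h : j - (L + 1) < 3 * L then w v ⟨j - (L + 1), h⟩ else 0

open Classical in
/-- The sketch given by four hash functions and random digits; `len v` is the length of the walk
from `v` to the root. -/
noncomputable def hashSketch {m L M : ℕ} (t k : ℕ) (len : Fin n → ℕ)
    (f : Fin 4 → Fin n → Fin m) (w : Fin n → Fin (3 * L) → Fin M) : Sketch n where
  numBuckets := 8 * m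
  numWeights := 4 * L + 1
  numDigits := L
  base := M
  numSteps := 8 * m + 4 * k
  bucket := hashBucket t f
  weight := digitWeight w
  gain x := ∑ v, if Touches (hashBucket t f) v (x / (4 * L + 1)) ∧ Even (len v) then
    digitWeight w v (x % (4 * L + 1)) else 0
  loss x := ∑ v, if Touches (hashBucket t f) v (x / (4 * L + 1)) ∧ ¬ Even (len v) then
    digitWeight w v (x % (4 * L + 1)) else 0

variable {m L M t k : ℕ} {len : Fin n → ℕ} {f : Fin 4 → Fin n → Fin m}
  {w : Fin n → Fin (3 * L) → Fin M}

/-- Refined values are below `2 * m`, so the hash functions use disjoint blocks of bucket numbers.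
-/
theorem eq_of_hashBucket_eq (hm : n ≤ m * t) {v u : Fin n} {h h' : ℕ} (hh : h < 4) (hh' : h' < 4)
    (e : hashBucket t f v h = hashBucket t f u h') :
    h = h' ∧ refine t (f ⟨h, hh⟩) v = refine t (f ⟨h, hh⟩) u := by
  have h1 := refine_lt hm (f ⟨h, hh⟩) v
  have h2 := refine_lt hm (f ⟨h', hh'⟩) u
  unfold hashBucket at e
  rw [dif_pos hh, dif_pos hh'] at e
  obtain ⟨rfl, h3⟩ := pairIndex_inj h1 h2 e
  exact ⟨rfl, h3⟩

theorem hashBucket_lt (hm : n ≤ m * t) (v : Fin n) {h : ℕ} (hh : h < 4) :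
    hashBucket t f v h < 8 * m := by
  have h1 := refine_lt hm (f ⟨h, hh⟩) v
  unfold hashBucket
  rw [dif_pos hh]
  interval_cases h <;> omega

theorem valid_hashSketch (hm0 : 0 < m) (hm : n ≤ m * t) (hn : n ≤ M ^ L) :
    (hashSketch t k len f w).Valid where
  numBuckets_pos := by simp only [hashSketch]; omega
  bucket_lt v h hh := hashBucket_lt hm v hh
  bucket_disjoint v u h h' hh hh' e := (eq_of_hashBucket_eq hm hh hh' e).1
  numDigits_lt := by simp only [hashSketch]; omega
  weight_zero v := by simp [hashSketch, digitWeight]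
  weight_succ v j hj := by
    simp only [hashSketch] at hj ⊢
    unfold digitWeight
    rw [if_neg (Nat.succ_ne_zero j), if_pos (by omega)]
    congr 3
    omega
  le_pow := hn

theorem digitWeight_le (hM : 2 ≤ M) (v : Fin n) (j : ℕ) : digitWeight w v j ≤ M := by
  unfold digitWeight
  split_ifs
  · omega
  · exact (Nat.mod_lt _ (by omega)).le
  · exact (w v _).isLt.le
  · omega

theorem card_nodesIn_hashSketch_le (ht : 0 < t) (hm : n ≤ m * t) (b : ℕ) :
    ((hashSketch t k len f w).nodesIn b).card ≤ t := by
  rcases Finset.eq_empty_or_nonempty ((hashSketch t k len f w).nodesIn b) with h0 | ⟨u, hu⟩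
  · simp [h0]
  · simp only [Sketch.nodesIn, Finset.mem_filter, Finset.mem_univ, true_and] at hu
    obtain ⟨h, hh, rfl⟩ := hu
    refine (Finset.card_le_card fun v hv => ?_).trans
      (card_refine_fiber_le ht (f ⟨h, hh⟩) (refine t (f ⟨h, hh⟩) u))
    simp only [Sketch.nodesIn, Finset.mem_filter, Finset.mem_univ, true_and] at hv ⊢
    obtain ⟨h', hh', e⟩ := hv
    obtain ⟨rfl, e'⟩ := eq_of_hashBucket_eq hm hh' hh e
    exact e'

/-- The table holds natural numbers only, so the signed coefficient of `d z` is stored as two sums,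
according to the parity of the walk to the root. -/
theorem gain_sub_loss_hashSketch {b j : ℕ} (hj : j < 4 * L + 1) :
    ((hashSketch t k len f w).gain (b * (4 * L + 1) + j) : ℝ) -
        (hashSketch t k len f w).loss (b * (4 * L + 1) + j) =
      ∑ v ∈ (hashSketch t k len f w).nodesIn b,
        (hashSketch t k len f w).weight v j * (-1 : ℝ) ^ len v := by
  have h3 : (b * (4 * L + 1) + j) / (4 * L + 1) = b := by
    rw [mul_comm, Nat.mul_add_div (by omega), Nat.div_eq_of_lt hj, add_zero]
  have h4 : (b * (4 * L + 1) + j) % (4 * L + 1) = j := by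
    rw [mul_comm, Nat.mul_add_mod, Nat.mod_eq_of_lt hj]
  rw [Sketch.nodesIn, Finset.sum_filter]
  unfold hashSketch
  dsimp only
  rw [h3, h4]
  push_cast
  rw [← Finset.sum_sub_distrib]
  refine Finset.sum_congr rfl fun v _ => ?_
  by_cases h1 : Touches (hashBucket t f) v b
  · by_cases h2 : Even (len v)
    · simp [h1, h2, h2.neg_one_pow]
    · simp [h1, h2, (Nat.not_even_iff_odd.1 h2).neg_one_pow]
  · simp [h1]

/-- Only the equations for the random weights are kept; they alone make ambiguity improbable. -/
theorem exists_digits_of_not_unambiguous {d : Fin n → ℝ} {A : Finset (Fin n)}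
    (h : ¬ (hashSketch t k len f w).Unambiguous d A) :
    2 ≤ A.card ∧ ∃ u, ∀ j, ∑ v ∈ A, ((w v j : ℕ) : ℝ) * d v = ((w u j : ℕ) : ℝ) * ∑ v ∈ A, d v := by
  simp only [Sketch.Unambiguous, Classical.not_imp, not_not] at h
  obtain ⟨h1, u, h2⟩ := h
  refine ⟨h1, u, fun j => ?_⟩
  have hj := j.isLt
  have h3 := h2 (L + 1 + j) (by simp only [hashSketch]; omega)
  have h4 : ∀ v, (hashSketch t k len f w).weight v (L + 1 + j) = w v j := by
    intro v
    have h5 : L + 1 + (j : ℕ) - (L + 1) = j := by omega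
    simp only [hashSketch, digitWeight]
    rw [if_neg (by omega), if_neg (by omega), dif_pos (by omega)]
    simp only [h5]
  simpa only [h4] using h3

end RandomSketch

/-! ### Combining the two sources of error under the uniform distribution. -/

section Probability

open Classical in
-- The exceptional set for the second coordinate may depend on the first; counting fibre by fibre
-- still adds the two proportions.
theorem card_bad_pair_le {F W : Type*} [Fintype F] [Fintype W] (B : Finset F) (E : F → Finset W)
    {a b : ℝ} (hB : (B.card : ℝ) ≤ a * Fintype.card F)
    (hE : ∀ f, ((E f).card : ℝ) ≤ b * Fintype.card W) :
    ((Finset.univ.filter fun x : F × W => x.1 ∈ B ∨ x.2 ∈ E x.1).card : ℝ) ≤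
      (a + b) * Fintype.card (F × W) := by
  have h : (Finset.univ.filter fun x : F × W => x.1 ∈ B ∨ x.2 ∈ E x.1) ⊆
      B ×ˢ Finset.univ ∪ Finset.univ.filter fun x : F × W => x.2 ∈ E x.1 := by
    intro x hx
    simpa using hx
  have h1 : (Finset.univ.filter fun x : F × W => x.2 ∈ E x.1).card = ∑ f, (E f).card := by
    rw [Finset.card_filter, Fintype.sum_prod_type]
    exact Finset.sum_congr rfl fun f _ => by simp
  have h2 : ((∑ f, (E f).card : ℕ) : ℝ) ≤ Fintype.card F * (b * Fintype.card W) := by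
    push_cast
    refine (Finset.sum_le_sum fun f _ => hE f).trans_eq ?_
    simp
  have h3 := (Finset.card_le_card h).trans (Finset.card_union_le _ _)
  rw [Finset.card_product, h1, Finset.card_univ] at h3
  have h4 : ((Finset.univ.filter fun x : F × W => x.1 ∈ B ∨ x.2 ∈ E x.1).card : ℝ) ≤
      B.card * Fintype.card W + (∑ f, (E f).card : ℕ) := by exact_mod_cast h3
  have h5 := mul_le_mul_of_nonneg_right hB (Nat.cast_nonneg (α := ℝ) (Fintype.card W))
  rw [Fintype.card_prod]
  push_cast at h2 h4 ⊢
  linarith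

theorem toOuterMeasure_map_uniform_le {Ω X : Type*} [Fintype Ω] [Nonempty Ω] (g : Ω → X)
    (S : Set X) (B : Finset Ω) (hB : ∀ x, g x ∈ S → x ∈ B) {ε : ℝ}
    (hε : (B.card : ℝ) ≤ ε * Fintype.card Ω) :
    ((PMF.uniformOfFintype Ω).map g).toOuterMeasure S ≤ ENNReal.ofReal ε := by
  classical
  have hpos : (0 : ℝ) < Fintype.card Ω := by exact_mod_cast Fintype.card_pos
  rw [PMF.toOuterMeasure_map_apply, PMF.toOuterMeasure_uniformOfFintype_apply]
  have h1 : Fintype.card (g ⁻¹' S) ≤ B.card := by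
    rw [← Set.toFinset_card]
    exact Finset.card_le_card fun x hx => hB x (by simpa using hx)
  rw [ENNReal.div_le_iff (by exact_mod_cast Fintype.card_ne_zero) (ENNReal.natCast_ne_top _),
    ← ENNReal.ofReal_natCast, ← ENNReal.ofReal_natCast, ← ENNReal.ofReal_mul' hpos.le]
  exact ENNReal.ofReal_le_ofReal ((Nat.cast_le.2 h1).trans hε)

end Probability

/-! ### Halting, recovery and error probability of the random design. -/

section Main

variable {n : ℕ} {G : SimpleGraph (Fin n)} {m L M t k : ℕ}

/-- The number of operations of the reconstruction. -/
theorem haltsWithin_hashSketch {z : Fin n} (p : ∀ v, G.Walk v z) (hm0 : 0 < m) (hm : n ≤ m * t)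
    (hn : n ≤ M ^ L) (f : Fin 4 → Fin n → Fin m) (w : Fin n → Fin (3 * L) → Fin M) (d : Fin n → ℝ)
    {T : ℝ} (hT : ((60 * (8 * m * (4 * L + 1) + 1) +
      720 * ((4 * L + 1 + 1) * (8 * m + 4 * k + 1)) : ℕ) : ℝ) ≤ T) :
    ((hashSketch t k (fun v => (p v).length) f w).design p).HaltsWithin reconstruct d T := by
  obtain ⟨s', c, h1, h2, -⟩ := runs_reconstruct
    (valid_hashSketch (k := k) (len := fun v => (p v).length) (f := f) (w := w) hm0 hm hn)
    (Sketch.initial_design_table _ p d) d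
  exact ⟨s', c, h1, (Nat.cast_le.2 h2).trans hT⟩

open Classical in
/-- The delays are found unless there is a core or an ambiguous mixture. -/
theorem recovers_hashSketch {z : Fin n} (p : ∀ v, G.Walk v z) (hm0 : 0 < m) (hm : n ≤ m * t)
    (hn : n ≤ M ^ L) (f : Fin 4 → Fin n → Fin m) (w : Fin n → Fin (3 * L) → Fin M) (d : Fin n → ℝ)
    (hk : (Finset.univ.filter fun v => d v ≠ 0).card ≤ k)
    (hcore : ¬ ∃ S ⊆ Finset.univ.filter fun v => d v ≠ 0, S.Nonempty ∧ ∀ h, IsCore (f h) S)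
    (hamb : ∀ i < 8 * m + 4 * k, (hashSketch t k (fun v => (p v).length) f w).Unambiguous d
      ((peel (8 * m) (hashBucket t f) (Finset.univ.filter fun v => d v ≠ 0) i).members
        (hashBucket t f) ((peel (8 * m) (hashBucket t f)
          (Finset.univ.filter fun v => d v ≠ 0) i).current (8 * m) i))) :
    ((hashSketch t k (fun v => (p v).length) f w).design p).Recovers reconstruct d := by
  obtain ⟨s', c, h1, -, h3⟩ := runs_reconstruct
    (valid_hashSketch (k := k) (len := fun v => (p v).length) (f := f) (w := w) hm0 hm hn)
    (Sketch.initial_design_table _ p d) d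
  refine ⟨s', c, h1, h3 rfl rfl (fun b hb j hj => ?_) ?_ ?_ hamb⟩
  · rw [Sketch.initial_design_mixture _ p d hb hj (gain_sub_loss_hashSketch hj), Sketch.nodesIn,
      Finset.sum_filter]
  · simp only [hashSketch]
    omega
  -- Sharing a refined bucket implies sharing the hash value, so a core for the buckets is a core
  -- for the original hash functions.
  · rintro ⟨S, hS, hne, h⟩
    refine hcore ⟨S, hS, hne, fun i v hv => ?_⟩
    obtain ⟨u, hu, huv, e⟩ := h i i.isLt v hv
    exact ⟨u, hu, huv, eq_of_refine_eq (eq_of_hashBucket_eq hm i.isLt i.isLt e).2⟩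

open Classical in
-- With `M ^ (3 * L) ≥ n ^ 3`, each pair of a step and a node `u` fails with probability at most `1
-- / n ^ 3`; there are `T * n` pairs. The sets `A i` are fixed before the digits `w` are drawn.
theorem card_exists_mixture_eq_le (hn : n ≤ M ^ L) (d : Fin n → ℝ) (T : ℕ)
    (A : ℕ → Finset (Fin n)) (hA : ∀ i, ∀ v ∈ A i, d v ≠ 0) :
    ((Finset.univ.filter fun w : Fin n → Fin (3 * L) → Fin M => ∃ i < T, 2 ≤ (A i).card ∧ ∃ u,
        ∀ j, ∑ v ∈ A i, ((w v j : ℕ) : ℝ) * d v = ((w u j : ℕ) : ℝ) * ∑ v ∈ A i, d v).card : ℝ) ≤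
      (T / n ^ 2 : ℝ) * Fintype.card (Fin n → Fin (3 * L) → Fin M) := by
  set Q := Fintype.card (Fin n → Fin (3 * L) → Fin M) with hQ
  rcases Nat.eq_zero_or_pos n with rfl | hn0
  · have : (Finset.univ.filter fun w : Fin 0 → Fin (3 * L) → Fin M => ∃ i < T, 2 ≤ (A i).card ∧ ∃ u,
        ∀ j, ∑ v ∈ A i, ((w v j : ℕ) : ℝ) * d v = ((w u j : ℕ) : ℝ) * ∑ v ∈ A i, d v) = ∅ := by
      apply Finset.filter_eq_empty_iff.2
      rintro w - ⟨i, -, -, u, -⟩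
      exact u.elim0
    rw [this]
    simp
  have hn' : (0 : ℝ) < n := by exact_mod_cast hn0
  have hone : ∀ i u, 2 ≤ (A i).card → ((Finset.univ.filter fun w : Fin n → Fin (3 * L) → Fin M =>
      ∀ j, ∑ v ∈ A i, ((w v j : ℕ) : ℝ) * d v =
        ((w u j : ℕ) : ℝ) * ∑ v ∈ A i, d v).card : ℝ) ≤ Q / n ^ 3 := by
    intro i u h2
    have h := card_mixture_eq_le (κ := Fin (3 * L)) (fun a : Fin M => ((a : ℕ) : ℝ))
      (fun a b hab => Fin.ext (Nat.cast_injective hab)) d (A i) h2 (hA i) u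
    rw [Fintype.card_fin, Fintype.card_fin, ← hQ] at h
    rw [le_div_iff₀ (by positivity)]
    have h3 : n ^ 3 ≤ M ^ (3 * L) := by
      rw [mul_comm, pow_mul]; exact Nat.pow_le_pow_left hn 3
    have h4 := (Nat.cast_le (α := ℝ)).2 ((Nat.mul_le_mul_left _ h3).trans h)
    rw [Nat.cast_mul, Nat.cast_pow] at h4
    convert h4
    rfl
  have hsub : (Finset.univ.filter fun w : Fin n → Fin (3 * L) → Fin M => ∃ i < T,
      2 ≤ (A i).card ∧ ∃ u, ∀ j, ∑ v ∈ A i, ((w v j : ℕ) : ℝ) * d v =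
        ((w u j : ℕ) : ℝ) * ∑ v ∈ A i, d v) ⊆
      ((Finset.range T).filter fun i => 2 ≤ (A i).card).biUnion fun i =>
        Finset.univ.biUnion fun u => Finset.univ.filter fun w : Fin n → Fin (3 * L) → Fin M =>
          ∀ j, ∑ v ∈ A i, ((w v j : ℕ) : ℝ) * d v = ((w u j : ℕ) : ℝ) * ∑ v ∈ A i, d v := by
    intro w hw
    simp only [Finset.mem_filter, Finset.mem_univ, true_and] at hw
    obtain ⟨i, hi, h2, u, hu⟩ := hw
    simp only [Finset.mem_biUnion, Finset.mem_filter, Finset.mem_range, Finset.mem_univ, true_and]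
    exact ⟨i, ⟨hi, h2⟩, u, hu⟩
  have h1 := (Finset.card_le_card hsub).trans (Finset.card_biUnion_le.trans
    (Finset.sum_le_sum fun i _ => Finset.card_biUnion_le))
  calc _ ≤ _ := Nat.cast_le.2 h1
    _ ≤ ∑ i ∈ (Finset.range T).filter fun i => 2 ≤ (A i).card, ∑ _u : Fin n, (Q / n ^ 3 : ℝ) := by
        push_cast
        refine Finset.sum_le_sum fun i hi => Finset.sum_le_sum fun u _ => ?_
        exact hone i u (Finset.mem_filter.1 hi).2
    _ ≤ ∑ i ∈ Finset.range T, ∑ _u : Fin n, (Q / n ^ 3 : ℝ) :=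
        Finset.sum_le_sum_of_subset_of_nonneg (Finset.filter_subset _ _) fun i _ _ =>
          Finset.sum_nonneg fun _ _ => by positivity
    _ = _ := by
        simp only [Finset.sum_const, Finset.card_univ, Fintype.card_fin, Finset.card_range,
          nsmul_eq_mul]
        field_simp

/-- The probability of error. -/
theorem error_hashSketch_le {z : Fin n} (p : ∀ v, G.Walk v z) (hm0 : 0 < m) (hm : n ≤ m * t)
    (hn : n ≤ M ^ L) (hkm : 100 * k ≤ m) (d : Fin n → ℝ)
    (hd : {v | d v ≠ 0}.ncard ≤ k)
    [Nonempty ((Fin 4 → Fin n → Fin m) × (Fin n → Fin (3 * L) → Fin M))] :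
    ((PMF.uniformOfFintype ((Fin 4 → Fin n → Fin m) × (Fin n → Fin (3 * L) → Fin M))).map
      fun x => (hashSketch t k (fun v => (p v).length) x.1 x.2).design p).toOuterMeasure
        {D | ¬ D.Recovers reconstruct d} ≤
      ENNReal.ofReal (1 / m + ((8 * m + 4 * k : ℕ) : ℝ) / n ^ 2) := by
  classical
  set supp := Finset.univ.filter fun v => d v ≠ 0 with hsupp
  have hk : supp.card ≤ k := by
    rw [← Set.ncard_coe_finset]
    simpa [hsupp] using hd
  -- The bucket contents met by error-free peeling are functions of `f` and the support alone, hence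
  -- independent of the random digits.
  let A : (Fin 4 → Fin n → Fin m) → ℕ → Finset (Fin n) := fun f i =>
    (peel (8 * m) (hashBucket t f) supp i).members
        (hashBucket t f) ((peel (8 * m) (hashBucket t f) supp i).current (8 * m) i)
  have hA : ∀ f i, ∀ v ∈ A f i, d v ≠ 0 := by
    intro f i v hv
    have hI := peelInvariant_peel (N := 8 * m) (bucket := hashBucket t f) (by omega)
      (fun v h hh => hashBucket_lt hm v hh) supp i
    have := hI.subset (PeelState.mem_members.1 hv).1
    simpa [hsupp] using this
  refine toOuterMeasure_map_uniform_le _ _ _ ?_ (card_bad_pair_le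
    (Finset.univ.filter fun f : Fin 4 → Fin n → Fin m =>
        ∃ S ⊆ supp, S.Nonempty ∧ ∀ h, IsCore (f h) S)
    (fun f => Finset.univ.filter fun w : Fin n → Fin (3 * L) → Fin M => ∃ i < 8 * m + 4 * k,
      2 ≤ (A f i).card ∧ ∃ u, ∀ j, ∑ v ∈ A f i, ((w v j : ℕ) : ℝ) * d v =
        ((w u j : ℕ) : ℝ) * ∑ v ∈ A f i, d v)
    (card_exists_isCore_le hm0 supp (by omega))
    fun f => card_exists_mixture_eq_le hn d _ (A f) (hA f))
  intro x hx
  simp only [Finset.mem_filter, Finset.mem_univ, true_and]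
  by_contra hgood
  push Not at hgood
  apply hx
  refine recovers_hashSketch p hm0 hm hn x.1 x.2 d hk ?_ fun i hi => ?_
  · rintro ⟨S, h1, h2, h3⟩
    obtain ⟨h, h4⟩ := hgood.1 S h1 h2
    exact h4 (h3 h)
  · by_contra hun
    obtain ⟨h2, u, hu⟩ := exists_digits_of_not_unambiguous hun
    obtain ⟨j, hj⟩ := hgood.2 i hi h2 u
    exact hj (hu j)

end Main

end Tomography

/-- There is one reconstruction program `A` such that for all lower bounds `ρ₀` on the design
parameter `ρ` there is a constant `C` with the following property. For all parameters and all
connected networks there is a distribution over measurement designs (chosen without knowledge of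
the delays) for which the number of measurements, the probability of error, the number of
operations of `A`, and the lengths of the measurement paths obey the stated bounds. -/
theorem mainTheorem3 :
    ∃ A : Tomography.Program, ∀ ρ₀ : ℝ, 0 < ρ₀ → ∃ C : ℝ, 0 < C ∧
      ∀ (n k M : ℕ) (ρ : ℝ), 2 ≤ n → 1 ≤ k → 2 ≤ M → ρ₀ ≤ ρ → ρ * k ≤ n →
      ∀ G : SimpleGraph (Fin n), G.Connected →
      ∃ μ : PMF (Tomography.Design G),
        -- the number of measurements
        (∀ D ∈ μ.support,
          (D.routes.length : ℝ) ≤ C * (ρ * k * (⌈Real.log n / Real.log M⌉ : ℝ))) ∧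
        -- the probability of error, for each fixed delay vector
        (∀ d : Fin n → ℝ, Tomography.Admissible G k d →
          μ.toOuterMeasure {D | ¬ D.Recovers A d} ≤ ENNReal.ofReal (C / (ρ * k))) ∧
        -- the number of operations of the reconstruction
        (∀ D ∈ μ.support, ∀ d : Fin n → ℝ, Tomography.Admissible G k d →
          D.HaltsWithin A d (C * (ρ * k * (⌈Real.log n / Real.log M⌉ : ℝ)))) ∧
        -- the numbers of links and of hops of each measurement path
        (∀ D ∈ μ.support, ∀ p ∈ D.routes,
          (p.numLinks : ℝ) ≤ C * (G.diam * n / (ρ * k)) ∧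
          (p.numHops : ℝ) ≤ C * (G.diam * M * n / (ρ * k))) := by
  refine ⟨Tomography.reconstruct, fun ρ₀ hρ₀ => ?_⟩
  -- The first summand of `c` ensures `100 * k ≤ m` and the second `X ≤ m`; the extra `1 / ρ₀` in
  -- `c₁` absorbs the rounding of `m`, as `1 ≤ X / ρ₀`.
  set c : ℝ := 100 / ρ₀ + 1 with hc
  set c₁ : ℝ := c + 1 / ρ₀ with hc₁
  have hc1 : 1 ≤ c := by rw [hc]; linarith [show (0 : ℝ) ≤ 100 / ρ₀ by positivity]
  have hc₁1 : 1 ≤ c₁ := by rw [hc₁]; linarith [show (0 : ℝ) ≤ 1 / ρ₀ by positivity]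
  refine ⟨60000 * c₁, by positivity, ?_⟩
  intro n k M ρ hn hk hM hρ hρn G hG
  set X : ℝ := ρ * k with hX
  have hk' : (1 : ℝ) ≤ k := by exact_mod_cast hk
  have hX₀ : ρ₀ ≤ X := by nlinarith
  have hX0 : 0 < X := hρ₀.trans_le hX₀
  -- the number of values of each hash function
  set m : ℕ := ⌈c * X⌉₊ with hm
  have hmX : c * X ≤ m := Nat.le_ceil _
  have hmX' : X ≤ m := le_trans (by nlinarith) hmX
  have hm0' : (0 : ℝ) < m := hX0.trans_le hmX'
  have hm0 : 0 < m := by exact_mod_cast hm0'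
  have hm1 : (m : ℝ) ≤ c₁ * X := by
    have h1 : (m : ℝ) < c * X + 1 := Nat.ceil_lt_add_one (by positivity)
    have h2 : 1 ≤ 1 / ρ₀ * X := by
      rw [div_mul_eq_mul_div, one_mul, one_le_div hρ₀]; exact hX₀
    rw [hc₁]
    linarith
  have hkm : 100 * k ≤ m := by
    have h1 : (100 * k : ℝ) ≤ 100 / ρ₀ * X := by
      rw [div_mul_eq_mul_div, le_div_iff₀ hρ₀, hX]
      nlinarith
    have h2 : (100 * k : ℝ) ≤ m := by
      rw [hc] at hmX
      linarith
    exact_mod_cast h2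
  -- the size of the buckets
  set t : ℕ := n / m + 1 with ht
  have hmt : n ≤ m * t := (Nat.lt_mul_div_succ n hm0).le
  have hn' : (0 : ℝ) < n := by exact_mod_cast (by omega : 0 < n)
  have ht' : (t : ℝ) ≤ 2 * (n / X) := by
    have h1 : ((n / m : ℕ) : ℝ) ≤ n / X := Nat.cast_div_le.trans (by gcongr)
    have h2 : 1 ≤ n / X := by rwa [one_le_div hX0]
    rw [ht]
    push_cast
    linarith
  have ht0 : 0 < t := Nat.succ_pos _
  -- From here on `t` enters only through `n ≤ m * t`, `0 < t` and `t ≤ 2 * (n / X)`.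
  clear_value t
  -- the number of digits
  set L : ℕ := Nat.clog M n with hL
  have hL1 : 1 ≤ L := Nat.clog_pos (by omega) (by omega)
  have hnL : n ≤ M ^ L := Nat.le_pow_clog (by omega) n
  have hLceil : ((⌈Real.log n / Real.log M⌉ : ℤ) : ℝ) = L := by
    have h1 : Real.log n / Real.log M = Real.logb M n := rfl
    rw [h1, Real.ceil_logb_natCast (Nat.cast_nonneg n), Int.clog_natCast, ← hL]
    rfl
  rw [hLceil]
  have hL' : (1 : ℝ) ≤ L := by exact_mod_cast hL1
  have hmL : (m : ℝ) * L ≤ c₁ * (X * L) := by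
    rw [← mul_assoc]; gcongr
  have hmL1 : 1 ≤ m * L := Nat.mul_pos hm0 hL1
  -- the walks to the root
  let z : Fin n := ⟨0, by omega⟩
  have hwalk : ∀ v, ∃ p : G.Walk v z, p.length ≤ G.diam := by
    intro v
    have : Nonempty (Fin n) := ⟨z⟩
    obtain ⟨p, hp⟩ := hG.exists_walk_length_eq_dist v z
    exact ⟨p, hp.trans_le (SimpleGraph.dist_le_diam (SimpleGraph.connected_iff_ediam_ne_top.1 hG))⟩
  choose p hp using hwalk
  have : Nonempty (Fin m) := ⟨⟨0, hm0⟩⟩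
  have : Nonempty (Fin M) := ⟨⟨0, by omega⟩⟩
  refine ⟨(PMF.uniformOfFintype ((Fin 4 → Fin n → Fin m) × (Fin n → Fin (3 * L) → Fin M))).map
      fun x => (Tomography.hashSketch t k (fun v => (p v).length) x.1 x.2).design p,
    fun D hD => ?_, fun d hd => ?_, fun D hD d _ => ?_, fun D hD r hr => ?_⟩
  · obtain ⟨x, -, rfl⟩ := (PMF.mem_support_map_iff _ _ _).1 hD
    -- The number of routes is `2 * (8 * m * (4 * L + 1)) + 1 = 64 * m * L + 16 * m + 1`.
    have h1 : ((Tomography.hashSketch t k (fun v => (p v).length) x.1 x.2).design p).routes.length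
        ≤ 81 * (m * L) := by
      simp only [Tomography.Sketch.design, List.length_map, List.length_range,
        Tomography.hashSketch]
      nlinarith
    refine (Nat.cast_le.2 h1).trans ?_
    push_cast
    nlinarith [show 0 ≤ c₁ * (X * L) by positivity]
  · refine (Tomography.error_hashSketch_le p hm0 hmt hnL hkm d hd.1).trans
      (ENNReal.ofReal_le_ofReal ?_)
    have h1 : (1 : ℝ) / m ≤ 1 / X := by gcongr
    have h2 : ((8 * m + 4 * k : ℕ) : ℝ) ≤ 9 * (c₁ * X) := by
      have h3 : 8 * m + 4 * k ≤ 9 * m := by omega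
      refine (Nat.cast_le.2 h3).trans ?_
      push_cast
      linarith
    -- One factor `X` in the numerator is traded against `n ^ 2 ≥ X ^ 2`; this is where `ρ * k ≤ n`
    -- enters the error bound.
    have h3 : ((8 * m + 4 * k : ℕ) : ℝ) / n ^ 2 ≤ 9 * c₁ / X := by
      rw [div_le_div_iff₀ (by positivity) hX0]
      have h4 : X ^ 2 ≤ (n : ℝ) ^ 2 := pow_le_pow_left₀ hX0.le hρn 2
      calc _ ≤ 9 * (c₁ * X) * X := by gcongr
        _ = 9 * c₁ * X ^ 2 := by ring
        _ ≤ _ := by gcongr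
    calc _ ≤ 1 / X + 9 * c₁ / X := add_le_add h1 h3
      _ = (1 + 9 * c₁) / X := by rw [add_div]
      _ ≤ _ := by gcongr; linarith
  · obtain ⟨x, -, rfl⟩ := (PMF.mem_support_map_iff _ _ _).1 hD
    refine Tomography.haltsWithin_hashSketch p hm0 hmt hnL x.1 x.2 d ?_
    have h1 : 60 * (8 * m * (4 * L + 1) + 1) +
        720 * ((4 * L + 1 + 1) * (8 * m + 4 * k + 1)) ≤ 60000 * (m * L) := by
      -- The estimates `1 ≤ L`, `1 ≤ m` and `100 * k ≤ m` absorb the lower-order terms.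
      have h2 : (4 * L + 1 + 1) * (8 * m + 4 * k + 1) ≤ (6 * L) * (10 * m) :=
        Nat.mul_le_mul (by omega) (by omega)
      have h3 : 8 * m * (4 * L + 1) ≤ 8 * m * (5 * L) := Nat.mul_le_mul_left _ (by omega)
      nlinarith
    refine (Nat.cast_le.2 h1).trans ?_
    push_cast
    linarith
  · obtain ⟨x, -, rfl⟩ := (PMF.mem_support_map_iff _ _ _).1 hD
    simp only [Tomography.Sketch.design, List.mem_map] at hr
    obtain ⟨i, -, rfl⟩ := hr
    have hB := Tomography.card_nodesIn_hashSketch_le (k := k) (len := fun v => (p v).length)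
      (f := x.1) (w := x.2) ht0 hmt
    have h1 := Tomography.Sketch.numLinks_route_le _ p hp hB i
    have h2 := Tomography.Sketch.numHops_route_le _ p hp hB
      (fun v j => Tomography.digitWeight_le hM v j) i
    have hM' : (2 : ℝ) ≤ M := by exact_mod_cast hM
    have hD0 : (0 : ℝ) ≤ G.diam := Nat.cast_nonneg _
    have hnX : 0 ≤ (n : ℝ) / X := by positivity
    constructor
    · refine (Nat.cast_le.2 h1).trans ?_
      push_cast
      calc (G.diam : ℝ) * t ≤ G.diam * (2 * (n / X)) := by gcongr
        _ = 2 * (G.diam * n / X) := by ring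
        _ ≤ _ := by gcongr; linarith
    · refine (Nat.cast_le.2 h2).trans ?_
      push_cast
      -- Since `2 ≤ M`, the additive `4` is at most `2 * M`.
      calc (2 * (M : ℝ) + 4) * G.diam * t ≤ (4 * M) * G.diam * (2 * (n / X)) := by
            gcongr; linarith
        _ = 8 * (G.diam * M * n / X) := by ring
        _ ≤ _ := by gcongr; linarith
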